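/- Let $\hbar>0$ and $\alpha\in\mathbb R\setminus\{0\}$. Put $p=-i\hbar\,\frac{d}{dx}$, $f(x)=-\frac1{x-\alpha}-\frac1{x+\alpha}$, $$b=\tfrac1{\sqrt2}\Bigl(p-\tfrac{i\hbar}{2\alpha^2}x-i\hbar f(x)\Bigr),\qquad b^\dagger=\tfrac1{\sqrt2}\Bigl(p+\tfrac{i\hbar}{2\alpha^2}x+i\hbar f(x)\Bigr),$$ and $H_1=b^\dagger b$, $H_2=bb^\dagger$, regarded as differential operators acting on analytic functions of a complex variable away from $\pm\alpha$. Then $$H_1=\frac{p^2}{2}+\frac{\hbar^2x^2}{8\alpha^4}-\frac{5\hbar^2}{4\alpha^2},\qquad H_2=\frac{p^2}{2}+V-\frac{3\hbar^2}{4\alpha^2},\qquad V=\frac{\hbar^2x^2}{8\alpha^4}+\frac{\hbar^2}{(x-\alpha)^2}+\frac{\hbar^2}{(x+\alpha)^2},$$ and $H_2$ has no square-integrable eigenfunction. Here an eigenfunction with eigenvalue $E\in\mathbb C$ is a function $\psi$ on the real line, not identically zero on $\mathbb R\setminus\{\pm\alpha\}$, which on $\mathbb R\setminus\{\pm\alpha\}$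 is the restriction of a single analytic solution of $H_2\Psi=E\Psi$, that is, of a holomorphic solution on some connected open set $U$ with $\mathbb R\setminus\{\pm\alpha\}\subseteq U\subseteq\mathbb C\setminus\{\pm\alpha\}$ (so the branches of $\psi$ on the three intervals of $\mathbb R\setminus\{\pm\alpha\}$ are analytic continuations of one another); square-integrable means $\psi\in L^2(\mathbb R)$. -/

import Mathlib

namespace DressingChain

noncomputable section

/-- The momentum operator `p = -i ħ d/dz`, acting on functions of a complex variable. -/
def momentum (hbar : ℝ) (ψ : ℂ → ℂ) : ℂ → ℂ :=
  fun z => -Complex.I * hbar * deriv ψ z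

/-- The function `f(z) = -1/(z-α) - 1/(z+α)`. -/
def poleTerm (α : ℝ) (z : ℂ) : ℂ :=
  -1 / (z - α) - 1 / (z + α)

/-- `b = (p - (iħ/(2α²)) x - iħ f(x)) / √2`. -/
def b (hbar α : ℝ) (ψ : ℂ → ℂ) : ℂ → ℂ :=
  fun z => (momentum hbar ψ z - Complex.I * hbar / (2 * α ^ 2) * z * ψ z
    - Complex.I * hbar * poleTerm α z * ψ z) / (Real.sqrt 2 : ℂ)

/-- `b† = (p + (iħ/(2α²)) x + iħ f(x)) / √2`. -/
def bDagger (hbar α : ℝ) (ψ : ℂ → ℂ) : ℂ → ℂ :=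
  fun z => (momentum hbar ψ z + Complex.I * hbar / (2 * α ^ 2) * z * ψ z
    + Complex.I * hbar * poleTerm α z * ψ z) / (Real.sqrt 2 : ℂ)

/-- `H₁ = b† b`. -/
def H₁ (hbar α : ℝ) (ψ : ℂ → ℂ) : ℂ → ℂ :=
  bDagger hbar α (b hbar α ψ)

/-- `H₂ = b b†`. -/
def H₂ (hbar α : ℝ) (ψ : ℂ → ℂ) : ℂ → ℂ :=
  b hbar α (bDagger hbar α ψ)

/-- The potential `V = ħ² x²/(8α⁴) + ħ²/(x-α)² + ħ²/(x+α)²`. -/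
def V (hbar α : ℝ) (z : ℂ) : ℂ :=
  hbar ^ 2 * z ^ 2 / (8 * α ^ 4) + hbar ^ 2 / (z - α) ^ 2 + hbar ^ 2 / (z + α) ^ 2

/-- `ψ` is an eigenfunction of `H₂` on the real line with eigenvalue `E`: it is not identically
zero off the two poles, and it is the restriction to `ℝ ∖ {±α}` of a holomorphic solution of
`H₂ Ψ = E Ψ` on some connected open set `U ⊆ ℂ ∖ {±α}` containing `ℝ ∖ {±α}`.
So the branches of `ψ` on the three real intervals are analytic continuations of one another
along paths that avoid the poles (and are not chosen independently of each other); nothing is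
required of `ψ` at the poles or of its behaviour near them. -/
def IsEigenfunction (hbar α : ℝ) (E : ℂ) (ψ : ℝ → ℂ) : Prop :=
  (∃ x : ℝ, x ≠ α ∧ x ≠ -α ∧ ψ x ≠ 0) ∧
  ∃ (U : Set ℂ) (Ψ : ℂ → ℂ),
    IsOpen U ∧ IsConnected U ∧ (α : ℂ) ∉ U ∧ (-α : ℂ) ∉ U ∧
    (∀ x : ℝ, x ≠ α → x ≠ -α → (x : ℂ) ∈ U) ∧
    DifferentiableOn ℂ Ψ U ∧
    (∀ z ∈ U, H₂ hbar α Ψ z = E * Ψ z) ∧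
    (∀ x : ℝ, x ≠ α → x ≠ -α → Ψ x = ψ x)

end

end DressingChain

/-! The two formulas come from writing `b` and `b†` as `κ (∂ ± W)` with `κ² = -ħ²/2`: the products
are `κ² (∂² ± W' - W²)`, and the poles cancel in `W² - W'` but not in `W² + W'`.

For the absence of bound states, rescale by `α`, so that the poles sit at `±1` and the equation is
`f'' = (w² + w' - ε) f` with `ε = 2Eα²/ħ²`. The Darboux partner `g = f' - w f` solves `g'' = (z²/4 -
(5/2 + ε)) g`, the harmonic oscillator, so `g` extends to an entire function. Since `U` is
connected, this is one function for all three real intervals.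

If `ε ≠ 0`, then `f = -(g' + w g)/ε`. Square-integrability of `f` forces rapid decay of `f` and
`f'`, hence of `g` and `g'`, so `g = c He_m(x) exp(-x²/4)` with `ε = m - 2` (or `g = 0`). It also
forbids a simple pole of `f` at `1`, so `g(1) = 0`. But `He_m(1) ≠ 0` unless `m = 2`, the excluded
case; hence `g = 0` and `f = 0`. The nonvanishing is arithmetic: `He_m(1)` is `1` modulo an odd
number at least `3` when `m ≥ 3` (`eval_one_hermite_ne_zero`).

If `ε = 0`, then `g = c G` with `G = (z² - 1) exp(-z²/4)`, and `(f G)' = c G²`. Absence of poles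
makes `f G` vanish at both `±1`, so `c ∫ G²` over `[-1, 1]` is zero. Thus `c = 0`, then `f G = 0`.
-/

/-! ### Hermite polynomials at `1` -/

section HermiteAtOne

open Polynomial Nat

/-- With `N = 2n + k`, the coefficient is `± (2n-1)‼ C(N,k)`. Multiplying by `2^n n!` gives `(2n)!
C(N,2n) = N · (N-1)⋯(k+1)`. The last product has `2n - 1 ≥ n` consecutive factors and absorbs `n!`,
while `2^n` is coprime to the odd `N`. -/
theorem dvd_coeff_hermite_of_odd {N k : ℕ} (hN : Odd N) (hk : k < N) :
    (N : ℤ) ∣ (hermite N).coeff k := by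
  by_cases h : Even (N + k)
  swap
  · rw [coeff_hermite_of_odd_add (Nat.not_even_iff_odd.mp h)]
    exact dvd_zero _
  obtain ⟨n, rfl⟩ : ∃ n, N = 2 * n + k := by
    obtain ⟨m, hm⟩ := h
    exact ⟨m - k, by omega⟩
  have hn : 1 ≤ n := by omega
  rw [coeff_hermite_explicit, mul_assoc]
  refine Dvd.dvd.mul_left ?_ _
  suffices hs : (2 * n + k) ∣ (2 * n - 1)‼ * (2 * n + k).choose k by exact_mod_cast hs
  have hcop : Nat.Coprime (2 * n + k) (2 ^ n) :=
    Nat.Coprime.pow_right _ (Nat.coprime_two_right.mpr hN)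
  refine hcop.dvd_of_dvd_mul_left ?_
  obtain ⟨t, ht⟩ : n ! ∣ (2 * n + k - 1).descFactorial (2 * n - 1) :=
    (Nat.factorial_dvd_factorial (by omega : n ≤ 2 * n - 1)).trans
      (Nat.factorial_dvd_descFactorial _ _)
  refine ⟨t, Nat.eq_of_mul_eq_mul_left (Nat.factorial_pos n) ?_⟩
  have h1 : (2 * n)! = 2 ^ n * n ! * (2 * n - 1)‼ := by
    obtain ⟨m, rfl⟩ : ∃ m, n = m + 1 := ⟨n - 1, by omega⟩
    rw [← Nat.doubleFactorial_two_mul]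
    exact Nat.factorial_eq_mul_doubleFactorial (2 * m + 1)
  have h2 : (2 * n + k).descFactorial (2 * n) =
      (2 * n + k) * (2 * n + k - 1).descFactorial (2 * n - 1) := by
    obtain ⟨m, rfl⟩ : ∃ m, n = m + 1 := ⟨n - 1, by omega⟩
    have := Nat.succ_descFactorial_succ (2 * m + 1 + k) (2 * m + 1)
    rw [show 2 * (m + 1) + k = 2 * m + 1 + k + 1 by ring]
    exact this
  have h3 : (2 * n + k).choose k = (2 * n + k).choose (2 * n) :=
    (Nat.choose_symm_add).symm
  rw [Nat.descFactorial_eq_factorial_mul_choose, ht, h1, ← h3] at h2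
  linarith

theorem eval_one_hermite_of_odd {N : ℕ} (hN : Odd N) :
    (N : ℤ) ∣ (hermite N).eval 1 - 1 := by
  rw [eval_eq_sum_range, natDegree_hermite, Finset.sum_range_succ, coeff_hermite_self]
  simp only [one_pow, mul_one, add_sub_cancel_right]
  exact Finset.dvd_sum fun k hk => dvd_coeff_hermite_of_odd hN (Finset.mem_range.mp hk)

/-- Differentiation puts a factor `N` on the leading coefficient; the lower ones are multiples of
`N` already. -/
theorem eval_one_derivative_hermite_of_odd {N : ℕ} (hN : Odd N) :
    (N : ℤ) ∣ (derivative (hermite N)).eval 1 := by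
  rw [derivative_eval, Polynomial.sum_over_range _ (by simp), natDegree_hermite]
  refine Finset.dvd_sum fun k hk => ?_
  rcases (Nat.lt_succ_iff.mp (Finset.mem_range.mp hk)).lt_or_eq with h | rfl
  · exact ((dvd_coeff_hermite_of_odd hN h).mul_right _).mul_right _
  · simp

/-- Among the probabilists' Hermite polynomials, only `X ^ 2 - 1` vanishes at `1`. -/
theorem eval_one_hermite_ne_zero {n : ℕ} (hn : n ≠ 2) : (hermite n).eval 1 ≠ 0 := by
  have key : ∀ N : ℕ, 3 ≤ N → ¬ (N : ℤ) ∣ 1 := fun N hN h => by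
    have := Int.le_of_dvd one_pos h
    omega
  rcases Nat.even_or_odd n with h | h
  · rcases Nat.eq_zero_or_pos n with rfl | hpos
    · simp
    obtain ⟨N, rfl⟩ : ∃ N, n = N + 1 := ⟨n - 1, by omega⟩
    have hN : Odd N := by
      rcases Nat.even_or_odd N with h' | h'
      · exact absurd h (Nat.not_even_iff_odd.mpr h'.add_one)
      · exact h'
    intro h0
    have h3 : 3 ≤ N := by
      obtain ⟨m, rfl⟩ := hN
      omega
    -- `He_{N+1}(1) = He_N(1) - He_N'(1)` is `1` modulo the odd number `N`.
    rw [hermite_succ, eval_sub, eval_mul, eval_X, one_mul] at h0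
    refine key N h3 ?_
    have := dvd_sub (eval_one_derivative_hermite_of_odd hN) (eval_one_hermite_of_odd hN)
    rwa [sub_eq_zero.mp h0, sub_sub_cancel] at this
  · intro h0
    have h1 := eval_one_hermite_of_odd h
    rw [h0, zero_sub, dvd_neg] at h1
    by_cases h3 : 3 ≤ n
    · exact key n h3 h1
    · have : n = 1 := by
        obtain ⟨m, rfl⟩ := h
        omega
      subst this
      simp at h0

end HermiteAtOne

/-! ### Entire solutions of the oscillator equation -/

section EntireSolutions

/-- The sum of the power series with coefficients `u`. -/
noncomputable def seriesSum (u : ℕ → ℂ) (z : ℂ) : ℂ := ∑' k, u k * z ^ k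

/-- The coefficients of the derivative of the power series with coefficients `u`. -/
def shiftCoeff (u : ℕ → ℂ) (k : ℕ) : ℂ := (k + 1) * u (k + 1)

/-- Cauchy-type bounds for every radius, so that the power series is entire. -/
def RapidCoeff (u : ℕ → ℂ) : Prop := ∀ r : ℝ, 0 < r → ∃ C : ℝ, ∀ k, ‖u k‖ * r ^ k ≤ C

theorem RapidCoeff.exists_summable_bound {u : ℕ → ℂ} (hu : RapidCoeff u) {r : ℝ} (hr : 0 < r) :
    ∃ v : ℕ → ℝ, Summable v ∧ ∀ k, ∀ z : ℂ, ‖z‖ ≤ r → ‖u k * z ^ k‖ ≤ v k := by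
  -- The bound at radius `2r` yields a geometric series of ratio `1/2` at radius `r`.
  obtain ⟨C, hC⟩ := hu (2 * r) (by positivity)
  refine ⟨fun k => C * (1 / 2) ^ k, summable_geometric_two.mul_left C, fun k z hz => ?_⟩
  have h1 : ‖u k‖ * r ^ k ≤ C * (1 / 2) ^ k := by
    have := hC k
    rw [mul_pow] at this
    rw [one_div, inv_pow, ← div_eq_mul_inv, le_div_iff₀ (by positivity)]
    linarith
  rw [norm_mul, norm_pow]
  refine le_trans ?_ h1
  gcongr

theorem RapidCoeff.hasSum {u : ℕ → ℂ} (hu : RapidCoeff u) (z : ℂ) :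
    HasSum (fun k => u k * z ^ k) (seriesSum u z) := by
  obtain ⟨v, hv, hb⟩ := hu.exists_summable_bound (r := ‖z‖ + 1) (by positivity)
  exact (Summable.of_norm_bounded hv fun k => hb k z (by linarith)).hasSum

theorem RapidCoeff.shift {u : ℕ → ℂ} (hu : RapidCoeff u) : RapidCoeff (shiftCoeff u) := by
  intro r hr
  obtain ⟨C, hC⟩ := hu (2 * r) (by positivity)
  refine ⟨C / r, fun k => ?_⟩
  have h := hC (k + 1)
  have hk : ((k : ℝ) + 1) ≤ 2 ^ (k + 1) := by
    exact_mod_cast (Nat.lt_two_pow_self (n := k + 1)).le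
  rw [le_div_iff₀ hr, shiftCoeff, norm_mul]
  have h1 : ‖(k : ℂ) + 1‖ = (k : ℝ) + 1 := by
    exact_mod_cast Complex.norm_natCast (k + 1)
  rw [h1]
  calc ((k : ℝ) + 1) * ‖u (k + 1)‖ * r ^ k * r
      = ((k : ℝ) + 1) * (‖u (k + 1)‖ * r ^ (k + 1)) := by ring
    _ ≤ 2 ^ (k + 1) * (‖u (k + 1)‖ * r ^ (k + 1)) := by gcongr
    _ = ‖u (k + 1)‖ * (2 * r) ^ (k + 1) := by ring
    _ ≤ C := h

theorem RapidCoeff.hasDerivAt {u : ℕ → ℂ} (hu : RapidCoeff u) (z : ℂ) :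
    HasDerivAt (seriesSum u) (seriesSum (shiftCoeff u) z) z := by
  obtain ⟨v, hv, hb⟩ := hu.exists_summable_bound (r := ‖z‖ + 1) (by positivity)
  have hd : ∀ k, DifferentiableOn ℂ (fun w : ℂ => u k * w ^ k) (Metric.ball 0 (‖z‖ + 1)) :=
    fun k => by fun_prop
  have hle : ∀ k, ∀ w ∈ Metric.ball (0 : ℂ) (‖z‖ + 1), ‖u k * w ^ k‖ ≤ v k := fun k w hw =>
    hb k w (by simpa using (mem_ball_zero_iff.mp hw).le)
  have hz : z ∈ Metric.ball (0 : ℂ) (‖z‖ + 1) := by simp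
  have h1 := Complex.hasSum_deriv_of_summable_norm hv hd Metric.isOpen_ball hle hz
  have h2 := ((Complex.differentiableOn_tsum_of_summable_norm hv hd Metric.isOpen_ball
    hle).differentiableAt (Metric.isOpen_ball.mem_nhds hz)).hasDerivAt
  have h3 : deriv (fun w => ∑' k, u k * w ^ k) z = seriesSum (shiftCoeff u) z := by
    rw [← hasSum_nat_add_iff' 1] at h1
    have h4 := h1.unique (a₂ := seriesSum (shiftCoeff u) z)
      (by simpa [shiftCoeff, mul_comm, mul_left_comm, mul_assoc] using hu.shift.hasSum z)
    simpa using h4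
  rw [h3] at h2
  exact h2

/-- The power series coefficients of the solution of `u'' - z u' + ν u = 0`
with `u 0 = a` and `u' 0 = b`. -/
noncomputable def hermiteCoeff (ν a b : ℂ) : ℕ → ℂ
  | 0 => a
  | 1 => b
  | k + 2 => (k - ν) / ((k + 2) * (k + 1)) * hermiteCoeff ν a b k

theorem rapidCoeff_hermiteCoeff (ν a b : ℂ) : RapidCoeff (hermiteCoeff ν a b) := by
  intro r hr
  -- Beyond this index the recursion no longer increases `‖u k‖ r^k`, so the first `N + 2` terms
  -- bound all of them.
  obtain ⟨N, hN⟩ := exists_nat_ge ((1 + ‖ν‖) * r ^ 2)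
  have hstep : ∀ k : ℕ, N ≤ k →
      ‖hermiteCoeff ν a b (k + 2)‖ * r ^ (k + 2) ≤ ‖hermiteCoeff ν a b k‖ * r ^ k := by
    intro k hk
    have hk' : (N : ℝ) ≤ k := by exact_mod_cast hk
    have h1 : ‖((k : ℂ) - ν) / ((k + 2) * (k + 1))‖ * r ^ 2 ≤ 1 := by
      have e1 : ‖(k : ℂ) + 2‖ = (k : ℝ) + 2 := by exact_mod_cast Complex.norm_natCast (k + 2)
      have e2 : ‖(k : ℂ) + 1‖ = (k : ℝ) + 1 := by exact_mod_cast Complex.norm_natCast (k + 1)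
      have e3 : ‖(k : ℂ) - ν‖ ≤ k + ‖ν‖ := by
        simpa using norm_sub_le (k : ℂ) ν
      rw [norm_div, norm_mul, e1, e2, div_mul_eq_mul_div, div_le_one (by positivity)]
      have e4 : (k : ℝ) + ‖ν‖ ≤ (1 + ‖ν‖) * (k + 1) := by
        nlinarith [norm_nonneg ν, Nat.cast_nonneg (α := ℝ) k]
      calc ‖(k : ℂ) - ν‖ * r ^ 2 ≤ (1 + ‖ν‖) * (k + 1) * r ^ 2 := by
            gcongr; exact e3.trans e4
        _ = ((1 + ‖ν‖) * r ^ 2) * (k + 1) := by ring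
        _ ≤ (k + 2) * (k + 1) := by gcongr; linarith
    rw [hermiteCoeff, norm_mul, pow_add]
    calc _ = (‖((k : ℂ) - ν) / ((k + 2) * (k + 1))‖ * r ^ 2) *
          (‖hermiteCoeff ν a b k‖ * r ^ k) := by ring
      _ ≤ 1 * (‖hermiteCoeff ν a b k‖ * r ^ k) := by gcongr
      _ = _ := one_mul _
  refine ⟨∑ j ∈ Finset.range (N + 2), ‖hermiteCoeff ν a b j‖ * r ^ j, fun k => ?_⟩
  induction k using Nat.strong_induction_on with
  | _ k ih =>
    by_cases hk : k < N + 2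
    · exact Finset.single_le_sum (f := fun j => ‖hermiteCoeff ν a b j‖ * r ^ j)
        (fun j _ => by positivity) (Finset.mem_range.mpr hk)
    · obtain ⟨j, rfl⟩ : ∃ j, k = j + 2 := ⟨k - 2, by omega⟩
      exact (hstep j (by omega)).trans (ih j (by omega))

theorem seriesSum_hermiteCoeff_ode (ν a b z : ℂ) :
    seriesSum (shiftCoeff (shiftCoeff (hermiteCoeff ν a b))) z =
      z * seriesSum (shiftCoeff (hermiteCoeff ν a b)) z -
        ν * seriesSum (hermiteCoeff ν a b) z := by
  have hu := rapidCoeff_hermiteCoeff ν a b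
  have h1 : HasSum (fun k : ℕ => (k : ℂ) * hermiteCoeff ν a b k * z ^ k)
      (z * seriesSum (shiftCoeff (hermiteCoeff ν a b)) z) := by
    rw [← hasSum_nat_add_iff' 1]
    have := (hu.shift.hasSum z).mul_left z
    simp only [Finset.range_one, Finset.sum_singleton, Nat.cast_zero, zero_mul, sub_zero]
    convert! this using 2 with k
    simp only [shiftCoeff]
    push_cast
    ring
  refine HasSum.unique (hu.shift.shift.hasSum z) ?_
  convert! h1.sub ((hu.hasSum z).mul_left ν) using 2 with k
  simp only [shiftCoeff, hermiteCoeff]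
  have e1 : (k : ℂ) + 2 ≠ 0 := by exact_mod_cast (by omega : k + 2 ≠ 0)
  have e2 : (k : ℂ) + 1 ≠ 0 := by exact_mod_cast (by omega : k + 1 ≠ 0)
  push_cast
  field_simp
  ring

theorem seriesSum_zero (u : ℕ → ℂ) : seriesSum u 0 = u 0 := by
  rw [seriesSum, tsum_eq_single 0 (fun k hk => by simp [hk])]
  simp

theorem hasDerivAt_cexp_neg_sq_div_four (z : ℂ) :
    HasDerivAt (fun z : ℂ => Complex.exp (-z ^ 2 / 4)) (Complex.exp (-z ^ 2 / 4) * (-z / 2)) z := by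
  have h : HasDerivAt (fun z : ℂ => -z ^ 2 / 4) (-z / 2) z := by
    convert! ((hasDerivAt_pow 2 z).neg.div_const 4) using 1
    push_cast
    ring
  exact h.cexp

/-- The oscillator equation has entire solutions with arbitrary initial data. -/
theorem exists_entire_oscillator_solution (lam a b : ℂ) :
    ∃ φ φ' : ℂ → ℂ, (∀ z, HasDerivAt φ (φ' z) z) ∧
      (∀ z, HasDerivAt φ' ((z ^ 2 / 4 - lam) * φ z) z) ∧ φ 0 = a ∧ φ' 0 = b := by
  -- The substitution `φ = exp(-z²/4) u` turns the equation into `u'' - z u' + ν u = 0`.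
  set ν := lam - 1 / 2 with hν
  set u := hermiteCoeff ν a b with hu_def
  have hu : RapidCoeff u := rapidCoeff_hermiteCoeff ν a b
  have he := hasDerivAt_cexp_neg_sq_div_four
  refine ⟨fun z => Complex.exp (-z ^ 2 / 4) * seriesSum u z,
    fun z => Complex.exp (-z ^ 2 / 4) *
      (seriesSum (shiftCoeff u) z - z / 2 * seriesSum u z), fun z => ?_, fun z => ?_, ?_, ?_⟩
  · convert! (he z).mul (hu.hasDerivAt z) using 1
    ring
  · convert! (he z).mul ((hu.shift.hasDerivAt z).sub
      (((hasDerivAt_id z).div_const 2).mul (hu.hasDerivAt z))) using 1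
    have := seriesSum_hermiteCoeff_ode ν a b z
    simp only [← hu_def] at this
    rw [this, hν]
    simp only [id, Pi.sub_apply, Pi.mul_apply]
    ring
  · simp [seriesSum_zero, hu_def, hermiteCoeff]
  · simp [seriesSum_zero, hu_def, hermiteCoeff, shiftCoeff]

/-- A solution of the oscillator equation on a connected open set extends to an entire one. -/
theorem exists_entire_extension {U : Set ℂ} (hU : IsOpen U) (hUc : IsPreconnected U) {lam : ℂ}
    {f f' : ℂ → ℂ} (hf : ∀ z ∈ U, HasDerivAt f (f' z) z)
    (hf' : ∀ z ∈ U, HasDerivAt f' ((z ^ 2 / 4 - lam) * f z) z) :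
    ∃ φ φ' : ℂ → ℂ, (∀ z, HasDerivAt φ (φ' z) z) ∧
      (∀ z, HasDerivAt φ' ((z ^ 2 / 4 - lam) * φ z) z) ∧
      (∀ z ∈ U, f z = φ z) ∧ ∀ z ∈ U, f' z = φ' z := by
  obtain ⟨e, e', he, he', he0, he0'⟩ := exists_entire_oscillator_solution lam 1 0
  obtain ⟨g, g', hg, hg', hg0, hg0'⟩ := exists_entire_oscillator_solution lam 0 1
  have hW : ∀ z, e z * g' z - e' z * g z = 1 := fun z => by
    have hd : ∀ z, HasDerivAt (fun z => e z * g' z - e' z * g z) 0 z := fun z => by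
      convert! ((he z).mul (hg' z)).sub ((he' z).mul (hg z)) using 1
      ring
    have := is_const_of_deriv_eq_zero (fun z => (hd z).differentiableAt) (fun z => (hd z).deriv) z 0
    simpa [he0, he0', hg0, hg0'] using this
  have hconst : ∀ h h' : ℂ → ℂ, (∀ z, HasDerivAt h (h' z) z) →
      (∀ z, HasDerivAt h' ((z ^ 2 / 4 - lam) * h z) z) →
      ∃ c, ∀ z ∈ U, f z * h' z - f' z * h z = c := fun h h' hh hh' => by
    have hd : ∀ z ∈ U, HasDerivAt (fun z => f z * h' z - f' z * h z) 0 z := fun z hz => by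
      convert! ((hf z hz).mul (hh' z)).sub ((hf' z hz).mul (hh z)) using 1
      ring
    exact hU.exists_is_const_of_deriv_eq_zero hUc
      (fun z hz => (hd z hz).differentiableAt.differentiableWithinAt) fun z hz => (hd z hz).deriv
  -- The Wronskians of `f` with a fundamental system of Wronskian `1` are constant on `U`, and
  -- Cramer's rule recovers `f` from them. Connectedness suffices; `U` need not be simply connected.
  obtain ⟨a, ha⟩ := hconst g g' hg hg'
  obtain ⟨b, hb⟩ := hconst e e' he he'
  refine ⟨fun z => a * e z - b * g z, fun z => a * e' z - b * g' z, fun z => ?_, fun z => ?_,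
    fun z hz => ?_, fun z hz => ?_⟩
  · exact ((he z).const_mul a).sub ((hg z).const_mul b)
  · convert! ((he' z).const_mul a).sub ((hg' z).const_mul b) using 1
    ring
  · simp only
    rw [← ha z hz, ← hb z hz]
    linear_combination (-f z) * hW z
  · simp only
    rw [← ha z hz, ← hb z hz]
    linear_combination (-f' z) * hW z

end EntireSolutions

/-! ### Decay of square-integrable solutions -/

section Decay

open Filter Topology Set MeasureTheory

theorem monotoneOn_Ioi_of_hasDerivAt_nonneg {f f' : ℝ → ℝ} {R : ℝ}
    (hf : ∀ x, R < x → HasDerivAt f (f' x) x) (h0 : ∀ x, R < x → 0 ≤ f' x) :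
    MonotoneOn f (Ioi R) := by
  refine monotoneOn_of_hasDerivWithinAt_nonneg (f' := f') (convex_Ioi R)
    (fun x hx => (hf x hx).continuousAt.continuousWithinAt) ?_ ?_
  · intro x hx
    rw [interior_Ioi] at hx ⊢
    exact (hf x hx).hasDerivWithinAt
  · intro x hx
    rw [interior_Ioi] at hx
    exact h0 x hx

/-- A nonnegative integrable function on a half-line with `F'' ≥ M² F` decays exponentially. -/
theorem le_mul_exp_of_integrableOn {F F' F'' : ℝ → ℝ} {R M : ℝ} (hM : 0 < M)
    (hF : ∀ x, R < x → HasDerivAt F (F' x) x) (hF' : ∀ x, R < x → HasDerivAt F' (F'' x) x)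
    (h0 : ∀ x, R < x → 0 ≤ F x) (hle : ∀ x, R < x → M ^ 2 * F x ≤ F'' x)
    (hInt : IntegrableOn F (Ioi R)) {x y : ℝ} (hx : R < x) (hxy : x ≤ y) :
    F y ≤ F x * Real.exp (-(M * (y - x))) := by
  have hmono : MonotoneOn F' (Ioi R) := monotoneOn_Ioi_of_hasDerivAt_nonneg hF' fun x hx =>
    (mul_nonneg (sq_nonneg M) (h0 x hx)).trans (hle x hx)
  -- `F` is convex; a positive slope at `a` would keep `F ≥ F' a` beyond `a + 2`, against
  -- integrability.
  have hneg : ∀ x, R < x → F' x ≤ 0 := by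
    intro a ha
    by_contra! hc
    have hm : MonotoneOn (fun y => F y - F' a * y) (Ioi a) :=
      monotoneOn_Ioi_of_hasDerivAt_nonneg (f' := fun y => F' y - F' a)
        (fun y hy => by
          simpa using! (hF y (ha.trans hy)).sub ((hasDerivAt_id y).const_mul (F' a)))
        fun y hy => sub_nonneg.mpr (hmono ha (ha.trans hy) (le_of_lt hy))
    have hlow : ∀ y ∈ Ioi (a + 2), F' a ≤ F y := fun y hy => by
      rw [mem_Ioi] at hy
      have h1 := hm (show a < a + 1 by linarith) (show a < y by linarith)
        (by linarith : a + 1 ≤ y)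
      have h2 := h0 (a + 1) (by linarith)
      simp only at h1
      nlinarith
    have hI : IntegrableOn (fun _ : ℝ => F' a) (Ioi (a + 2)) := by
      refine Integrable.mono' (hInt.mono_set (Ioi_subset_Ioi (by linarith)))
        aestronglyMeasurable_const ?_
      filter_upwards [ae_restrict_mem measurableSet_Ioi] with y hy
      rw [Real.norm_of_nonneg hc.le]
      exact hlow y hy
    rw [integrableOn_const_iff] at hI
    simp [hc.ne'] at hI
  have hexp : ∀ c x : ℝ, HasDerivAt (fun x => Real.exp (c * x)) (Real.exp (c * x) * c) x :=
    fun c x => by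
      have := ((hasDerivAt_id x).const_mul c).exp
      simpa using this
  -- `(F' + M F) exp(-M x)` is nondecreasing, so a positive value `K` of `F' + M F` at `a` would
  -- grow exponentially, while `F' + M F ≤ M F a`.
  have hK : ∀ x, R < x → F' x + M * F x ≤ 0 := by
    intro a ha
    by_contra! hc
    have hm : MonotoneOn (fun y => (F' y + M * F y) * Real.exp (-M * y)) (Ioi R) :=
      monotoneOn_Ioi_of_hasDerivAt_nonneg
        (f' := fun y => (F'' y + M * F' y) * Real.exp (-M * y) +
          (F' y + M * F y) * (Real.exp (-M * y) * -M))
        (fun y hy => ((hF' y hy).add ((hF y hy).const_mul M)).mul (hexp (-M) y))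
        fun y hy => by
          have h1 := hle y hy
          have h2 : 0 ≤ (F'' y - M ^ 2 * F y) * Real.exp (-M * y) :=
            mul_nonneg (by linarith) (Real.exp_pos _).le
          linarith
    set K := F' a + M * F a with hKdef
    -- At this point the upper bound `M F a` equals `K M (b - a)`, less than the lower bound `K
    -- exp(M (b - a))`.
    set b := a + F a / K with hb
    have hFa := h0 a ha
    have hab : a ≤ b := by
      rw [hb]
      have : 0 ≤ F a / K := div_nonneg hFa hc.le
      linarith
    have hRb : R < b := lt_of_lt_of_le ha hab
    have h1 := hm ha hRb hab
    simp only [← hKdef] at h1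
    have h2 : K * Real.exp (M * (b - a)) ≤ F' b + M * F b := by
      have h3 := mul_le_mul_of_nonneg_right h1 (Real.exp_pos (M * b)).le
      rw [mul_assoc, mul_assoc, ← Real.exp_add, ← Real.exp_add] at h3
      rw [show -M * a + M * b = M * (b - a) by ring, show -M * b + M * b = 0 by ring,
        Real.exp_zero, mul_one] at h3
      exact h3
    have h4 : F b ≤ F a := by
      have hanti : MonotoneOn (fun y => -F y) (Ioi R) :=
        monotoneOn_Ioi_of_hasDerivAt_nonneg (fun y hy => (hF y hy).neg)
          fun y hy => neg_nonneg.mpr (hneg y hy)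
      have := hanti ha hRb hab
      simp only at this
      linarith
    have h5 := Real.add_one_le_exp (M * (b - a))
    have h6 : K * (b - a) = F a := by
      rw [hb]
      field_simp
      ring
    have h7 := hneg b hRb
    nlinarith
  have hm : MonotoneOn (fun y => -(F y * Real.exp (M * y))) (Ioi R) :=
    monotoneOn_Ioi_of_hasDerivAt_nonneg
      (f' := fun y => -(F' y * Real.exp (M * y) + F y * (Real.exp (M * y) * M)))
      (fun y hy => ((hF y hy).mul (hexp M y)).neg)
      fun y hy => by
        have h2 := mul_nonneg (neg_nonneg.mpr (hK y hy)) (Real.exp_pos (M * y)).le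
        linarith
  have h1 := hm hx (lt_of_lt_of_le hx hxy) hxy
  simp only [neg_le_neg_iff] at h1
  have h3 := mul_le_mul_of_nonneg_right h1 (Real.exp_pos (-(M * y))).le
  rw [mul_assoc, mul_assoc, ← Real.exp_add, ← Real.exp_add] at h3
  rw [show M * y + -(M * y) = 0 by ring, Real.exp_zero, mul_one,
    show M * x + -(M * y) = -(M * (y - x)) by ring] at h3
  exact h3

/-- Decay along `l` faster than every power. -/
def RapidDecay (l : Filter ℝ) (f : ℝ → ℂ) : Prop :=
  ∀ k : ℕ, Tendsto (fun x : ℝ => (x : ℂ) ^ k * f x) l (𝓝 0)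

namespace RapidDecay

variable {l : Filter ℝ} {f g : ℝ → ℂ}

theorem tendsto (hf : RapidDecay l f) : Tendsto f l (𝓝 0) := by
  simpa using hf 0

theorem add (hf : RapidDecay l f) (hg : RapidDecay l g) : RapidDecay l fun x => f x + g x :=
  fun k => by simpa [mul_add] using (hf k).add (hg k)

theorem sub (hf : RapidDecay l f) (hg : RapidDecay l g) : RapidDecay l fun x => f x - g x :=
  fun k => by simpa [mul_sub] using (hf k).sub (hg k)

theorem const_mul (c : ℂ) (hf : RapidDecay l f) : RapidDecay l fun x => c * f x :=
  fun k => by simpa [mul_left_comm] using (hf k).const_mul c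

theorem ofReal_mul (hf : RapidDecay l f) : RapidDecay l fun x => (x : ℂ) * f x :=
  fun k => by simpa [pow_succ, mul_assoc] using hf (k + 1)

theorem tendsto_mul {h : ℝ → ℂ} {c : ℂ} (hh : Tendsto h l (𝓝 c)) (hf : RapidDecay l f) :
    RapidDecay l fun x => h x * f x :=
  fun k => by simpa [mul_left_comm] using hh.mul (hf k)

theorem congr' (hf : RapidDecay l f) (h : f =ᶠ[l] g) : RapidDecay l g := fun k =>
  (hf k).congr' (by filter_upwards [h] with x hx; rw [hx])

theorem sup {l' : Filter ℝ} (hf : RapidDecay l f) (hf' : RapidDecay l' f) :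
    RapidDecay (l ⊔ l') f := fun k => (hf k).sup (hf' k)

theorem of_comp_neg (hf : RapidDecay atTop fun x => f (-x)) : RapidDecay atBot f := fun k => by
  have h := ((hf k).comp tendsto_neg_atBot_atTop).const_mul ((-1 : ℂ) ^ k)
  rw [mul_zero] at h
  refine h.congr fun x => ?_
  simp only [Function.comp, neg_neg]
  rw [← mul_assoc, ← mul_pow]
  push_cast
  ring_nf

theorem of_norm_le {A : ℝ} {m : ℕ}
    (h : ∀ᶠ x in atTop, ‖f x‖ ≤ A * (x ^ m * Real.exp (-x))) : RapidDecay atTop f := fun k => by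
  have h1 := (Real.tendsto_pow_mul_exp_neg_atTop_nhds_zero (k + m)).const_mul A
  rw [mul_zero] at h1
  refine squeeze_zero_norm' ?_ h1
  filter_upwards [h, eventually_ge_atTop 0] with x hx hx0
  rw [norm_mul, norm_pow, Complex.norm_real, Real.norm_of_nonneg hx0]
  calc x ^ k * ‖f x‖ ≤ x ^ k * (A * (x ^ m * Real.exp (-x))) := by gcongr
    _ = _ := by ring

end RapidDecay

theorem hasDerivAt_normSq_second {ψ ψ' : ℝ → ℂ} {q : ℂ} {x : ℝ} (hψ : HasDerivAt ψ (ψ' x) x)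
    (hψ' : HasDerivAt ψ' (q * ψ x) x) :
    HasDerivAt (fun y => 2 * inner ℝ (ψ y) (ψ' y)) (2 * (‖ψ' x‖ ^ 2 + q.re * ‖ψ x‖ ^ 2)) x := by
  have h := (hψ.inner ℝ hψ').const_mul 2
  refine h.congr_deriv ?_
  rw [real_inner_self_eq_norm_sq]
  have : inner ℝ (ψ x) (q * ψ x) = q.re * ‖ψ x‖ ^ 2 := by
    rw [Complex.inner, ← Complex.normSq_eq_norm_sq, Complex.normSq_apply]
    simp
    ring
  rw [this]
  ring

/-- Square-integrable solutions of `ψ'' = Q ψ` at `+∞`, where `Re Q → ∞`, decay rapidly together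
with their derivatives. -/
theorem rapidDecay_of_integrableOn_sq {ψ ψ' Q : ℝ → ℂ} {R C : ℝ}
    (hψ : ∀ x, R < x → HasDerivAt ψ (ψ' x) x) (hψ' : ∀ x, R < x → HasDerivAt ψ' (Q x * ψ x) x)
    (hQ : Tendsto (fun x => (Q x).re) atTop atTop) (hC : ∀ᶠ x in atTop, ‖Q x‖ ≤ C * x ^ 2)
    (hInt : IntegrableOn (fun x => ‖ψ x‖ ^ 2) (Ioi R)) :
    RapidDecay atTop ψ ∧ RapidDecay atTop ψ' := by
  -- `Re Q ≥ 2` gives `F'' ≥ 4 F` for `F = ‖ψ‖²`, hence `ψ = O(exp(-x))`.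
  obtain ⟨S, hS⟩ := ((hQ.eventually_ge_atTop 2).and (hC.and
    ((eventually_gt_atTop R).and (eventually_ge_atTop 1)))).exists_forall_of_atTop
  have hS1 : 1 ≤ S := (hS S le_rfl).2.2.2
  have hdecay : ∀ x, S + 1 ≤ x →
      ‖ψ x‖ ^ 2 ≤ ‖ψ (S + 1)‖ ^ 2 * Real.exp (-(2 * (x - (S + 1)))) := fun x hx => by
    refine le_mul_exp_of_integrableOn (F := fun x => ‖ψ x‖ ^ 2)
      (F' := fun x => 2 * inner ℝ (ψ x) (ψ' x))
      (F'' := fun x => 2 * (‖ψ' x‖ ^ 2 + (Q x).re * ‖ψ x‖ ^ 2)) (R := S) two_pos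
      (fun y hy => (hψ y (hS y hy.le).2.2.1).norm_sq)
      (fun y hy => hasDerivAt_normSq_second (hψ y (hS y hy.le).2.2.1) (hψ' y (hS y hy.le).2.2.1))
      (fun y _ => sq_nonneg _) (fun y hy => ?_)
      (hInt.mono_set (Ioi_subset_Ioi (hS S le_rfl).2.2.1.le)) (lt_add_one S) hx
    have h1 := (hS y hy.le).1
    nlinarith [sq_nonneg ‖ψ' y‖, sq_nonneg ‖ψ y‖]
  set A := ‖ψ (S + 1)‖ * Real.exp (S + 1) with hA
  have hA0 : 0 ≤ A := by positivity
  have hbound : ∀ x, S + 1 ≤ x → ‖ψ x‖ ≤ A * Real.exp (-x) := fun x hx => by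
    refine le_of_sq_le_sq ?_ (by positivity) |>.trans_eq rfl
    refine (hdecay x hx).trans_eq ?_
    rw [hA, mul_pow, mul_pow, ← Real.exp_nat_mul, ← Real.exp_nat_mul, mul_assoc, ← Real.exp_add]
    congr 2
    push_cast
    ring
  have hC0 : 0 ≤ C := by
    have h1 := (norm_nonneg _).trans (hS S le_rfl).2.1
    exact nonneg_of_mul_nonneg_left h1 (by positivity)
  refine ⟨RapidDecay.of_norm_le (A := A) (m := 0) ?_,
    RapidDecay.of_norm_le (A := 2 * A + 4 * (C * A)) (m := 2) ?_⟩
  · filter_upwards [eventually_ge_atTop (S + 1)] with x hx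
    simpa using hbound x hx
  · filter_upwards [eventually_ge_atTop (S + 1)] with x hx
    have hx1 : 1 ≤ x := by linarith
    have hgt : ∀ y ∈ Icc x (x + 1), R < y := fun y hy => (hS y (by linarith [hy.1])).2.2.1
    have h2 : ∀ y ∈ Icc x (x + 1), ‖Q y * ψ y‖ ≤ 4 * (C * A) * (x ^ 2 * Real.exp (-x)) := by
      intro y hy
      have e1 := (hS y (by linarith [hy.1])).2.1
      have e2 := hbound y (by linarith [hy.1])
      have e3 : Real.exp (-y) ≤ Real.exp (-x) := Real.exp_le_exp.mpr (by linarith [hy.1])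
      have e4 : y ^ 2 ≤ 4 * x ^ 2 := by nlinarith [hy.1, hy.2]
      rw [norm_mul]
      calc ‖Q y‖ * ‖ψ y‖ ≤ (C * (4 * x ^ 2)) * (A * Real.exp (-x)) := by
            gcongr
            · exact e1.trans (by gcongr)
            · exact e2.trans (by gcongr)
        _ = _ := by ring
    have h3 : ∀ y ∈ Icc x (x + 1),
        ‖ψ' y - ψ' x‖ ≤ 4 * (C * A) * (x ^ 2 * Real.exp (-x)) := by
      intro y hy
      have := (convex_Icc x (x + 1)).norm_image_sub_le_of_norm_hasDerivWithin_le
        (fun z hz => (hψ' z (hgt z hz)).hasDerivWithinAt) h2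
        (left_mem_Icc.mpr (by linarith)) hy
      refine this.trans (mul_le_of_le_one_right (by positivity) ?_)
      rw [Real.norm_of_nonneg (by linarith [hy.1])]
      linarith [hy.2]
    -- First-order Taylor estimate on `[x, x + 1]`: the bound on `ψ'' = Q ψ` controls `ψ' x` by
    -- values of `ψ`.
    have h4 : ‖(ψ (x + 1) - (x + 1 : ℝ) * ψ' x) - (ψ x - (x : ℝ) * ψ' x)‖ ≤
        4 * (C * A) * (x ^ 2 * Real.exp (-x)) := by
      have := (convex_Icc x (x + 1)).norm_image_sub_le_of_norm_hasDerivWithin_le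
        (f := fun z : ℝ => ψ z - (z : ℂ) * ψ' x) (f' := fun z => ψ' z - ψ' x)
        (fun z hz => ((hψ z (hgt z hz)).sub (by
          simpa using (Complex.ofRealCLM.hasDerivAt (x := z)).mul_const (ψ' x)
            )).hasDerivWithinAt) h3
        (left_mem_Icc.mpr (by linarith)) (right_mem_Icc.mpr (by linarith))
      simpa using this
    have h5 : ‖ψ (x + 1)‖ ≤ A * (x ^ 2 * Real.exp (-x)) := by
      refine (hbound (x + 1) (by linarith)).trans ?_
      gcongr
      refine le_trans (Real.exp_le_exp.mpr (by linarith : -(x + 1) ≤ -x)) ?_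
      exact le_mul_of_one_le_left (Real.exp_pos _).le (one_le_pow₀ hx1)
    have h6 : ‖ψ x‖ ≤ A * (x ^ 2 * Real.exp (-x)) := by
      refine (hbound x hx).trans ?_
      gcongr
      exact le_mul_of_one_le_left (Real.exp_pos _).le (one_le_pow₀ hx1)
    have h7 : ψ' x = ψ (x + 1) - ψ x -
        ((ψ (x + 1) - (x + 1 : ℝ) * ψ' x) - (ψ x - (x : ℝ) * ψ' x)) := by
      push_cast
      ring
    rw [h7]
    calc _ ≤ ‖ψ (x + 1)‖ + ‖ψ x‖ + _ := (norm_sub_le _ _).trans (by gcongr; exact norm_sub_le _ _)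
      _ ≤ _ := by linarith

end Decay

/-! ### Rapidly decaying oscillator solutions are Hermite functions -/

section Oscillator

open Filter Topology Set

theorem eq_zero_of_convexOn_of_tendsto {F : ℝ → ℝ} (hF : ConvexOn ℝ univ F) (h0 : ∀ x, 0 ≤ F x)
    (hb : Tendsto F atBot (𝓝 0)) (ht : Tendsto F atTop (𝓝 0)) (x : ℝ) : F x = 0 := by
  refine le_antisymm ?_ (h0 x)
  have h1 : Tendsto (fun t => (1 / 2 : ℝ) * F (x - t) + (1 / 2) * F (x + t)) atTop (𝓝 0) := by
    have e1 : Tendsto (fun t : ℝ => x - t) atTop atBot := by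
      simpa [sub_eq_add_neg] using tendsto_atBot_add_const_left atTop x tendsto_neg_atTop_atBot
    have e2 : Tendsto (fun t : ℝ => x + t) atTop atTop :=
      tendsto_atTop_add_const_left atTop x tendsto_id
    have h := ((hb.comp e1).const_mul (1 / 2)).add ((ht.comp e2).const_mul (1 / 2))
    rwa [mul_zero, add_zero] at h
  refine ge_of_tendsto' h1 fun t => ?_
  have := hF.2 (mem_univ (x - t)) (mem_univ (x + t)) (by norm_num : (0 : ℝ) ≤ 1 / 2)
    (by norm_num : (0 : ℝ) ≤ 1 / 2) (by norm_num)
  simp only [smul_eq_mul] at this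
  convert! this using 2
  ring

/-- `φ` with derivative `φ'` solves `φ'' = (x² / 4 - lam) φ` on the real line. -/
structure OscillatorSolution (lam : ℂ) (φ φ' : ℝ → ℂ) : Prop where
  hasDerivAt : ∀ x, HasDerivAt φ (φ' x) x
  hasDerivAt' : ∀ x : ℝ, HasDerivAt φ' (((x : ℂ) ^ 2 / 4 - lam) * φ x) x

namespace OscillatorSolution

variable {lam : ℂ} {φ φ' : ℝ → ℂ}

/-- Here `Re (x²/4 - lam) ≥ 0`, so `‖φ‖²` is convex, and it tends to zero at both ends. -/
theorem eq_zero_of_re_nonpos (h : OscillatorSolution lam φ φ') (hlam : lam.re ≤ 0)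
    (hd : RapidDecay (cocompact ℝ) φ) (x : ℝ) : φ x = 0 := by
  have h1 : ∀ x, HasDerivAt (fun x => ‖φ x‖ ^ 2) (2 * inner ℝ (φ x) (φ' x)) x :=
    fun x => (h.hasDerivAt x).norm_sq
  have h2 := fun x => hasDerivAt_normSq_second (h.hasDerivAt x) (h.hasDerivAt' x)
  have hderiv : deriv (fun x => ‖φ x‖ ^ 2) = fun x => 2 * inner ℝ (φ x) (φ' x) :=
    funext fun x => (h1 x).deriv
  have hconv : ConvexOn ℝ univ (fun x => ‖φ x‖ ^ 2) := by
    refine convexOn_univ_of_deriv2_nonneg (fun x => (h1 x).differentiableAt) ?_ fun x => ?_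
    · rw [hderiv]
      exact fun x => (h2 x).differentiableAt
    · rw [Function.iterate_succ, Function.iterate_one, Function.comp, hderiv, (h2 x).deriv]
      have hq : 0 ≤ ((x : ℂ) ^ 2 / 4 - lam).re := by
        have : ((x : ℂ) ^ 2 / 4 - lam).re = x ^ 2 / 4 - lam.re := by
          rw [show (x : ℂ) ^ 2 / 4 = ((x ^ 2 / 4 : ℝ) : ℂ) by push_cast; rfl, Complex.sub_re,
            Complex.ofReal_re]
        rw [this]
        nlinarith [sq_nonneg x]
      positivity
  have ht : Tendsto (fun x => ‖φ x‖ ^ 2) (cocompact ℝ) (𝓝 0) := by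
    simpa using hd.tendsto.norm.pow 2
  rw [cocompact_eq_atBot_atTop, tendsto_sup] at ht
  have := eq_zero_of_convexOn_of_tendsto hconv (fun x => sq_nonneg _) ht.1 ht.2 x
  simpa using this

/-- The annihilation operator, which drives the induction on `lam.re`. -/
theorem lower (h : OscillatorSolution lam φ φ') :
    OscillatorSolution (lam - 1) (fun x => φ' x + x / 2 * φ x)
      (fun x => ((x : ℂ) ^ 2 / 4 - lam) * φ x + (1 / 2 * φ x + x / 2 * φ' x)) := by
  have hx : ∀ x : ℝ, HasDerivAt (fun x : ℝ => (x : ℂ)) 1 x := fun x => 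
    (hasDerivAt_id (x : ℂ)).comp_ofReal
  refine ⟨fun x => ?_, fun x => ?_⟩
  · exact (h.hasDerivAt' x).add (((hx x).div_const 2).mul (h.hasDerivAt x))
  · convert! (((((hx x).pow 2).div_const 4).sub_const lam).mul (h.hasDerivAt x)).add
      (((h.hasDerivAt x).const_mul (1 / 2)).add
        (((hx x).div_const 2).mul (h.hasDerivAt' x))) using 1
    simp only [Pi.pow_apply]
    ring

open Polynomial in
theorem eq_zero_or_eq_hermite_of_re_le (n : ℕ) :
    ∀ (lam : ℂ) (φ φ' : ℝ → ℂ), OscillatorSolution lam φ φ' → RapidDecay (cocompact ℝ) φ →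
      RapidDecay (cocompact ℝ) φ' → lam.re ≤ n → (∀ x, φ x = 0) ∨
      ∃ (m : ℕ) (c : ℂ), lam = m + 1 / 2 ∧
        ∀ x : ℝ, φ x = c * (aeval (x : ℂ) (hermite m) * Complex.exp (-(x : ℂ) ^ 2 / 4)) := by
  induction n with
  | zero => exact fun lam φ φ' h hd _ hlam => Or.inl (h.eq_zero_of_re_nonpos (by simpa using hlam) hd)
  | succ n ih =>
    intro lam φ φ' h hd hd' hlam
    -- Raising the lowered function returns a multiple of `φ`.
    have hup : ∀ x : ℝ, (lam - 1 / 2) * φ x =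
        x / 2 * (φ' x + x / 2 * φ x) -
          (((x : ℂ) ^ 2 / 4 - lam) * φ x + (1 / 2 * φ x + x / 2 * φ' x)) := fun x => by ring
    have hD : RapidDecay (cocompact ℝ) (fun x => φ' x + x / 2 * φ x) :=
      (hd'.add (hd.ofReal_mul.const_mul (1 / 2))).congr' (.of_forall fun x => by ring)
    have hD' : RapidDecay (cocompact ℝ)
        (fun x => ((x : ℂ) ^ 2 / 4 - lam) * φ x + (1 / 2 * φ x + x / 2 * φ' x)) :=
      ((hd.ofReal_mul.ofReal_mul.const_mul (1 / 4)).add ((hd.const_mul (1 / 2 - lam)).add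
        (hd'.ofReal_mul.const_mul (1 / 2)))).congr' (.of_forall fun x => by ring)
    rcases ih (lam - 1) _ _ h.lower hD hD' (by
      rw [Complex.sub_re, Complex.one_re]
      push_cast at hlam
      linarith) with h0 | ⟨m, c, hm, hc⟩
    -- A nonzero `φ` killed by lowering is the Gaussian ground state, `m = 0`.
    · by_cases hz : ∀ x, φ x = 0
      · exact Or.inl hz
      push Not at hz
      obtain ⟨a, ha⟩ := hz
      refine Or.inr ⟨0, φ 0, ?_, fun x => ?_⟩
      · have hχ' : ((a : ℂ) ^ 2 / 4 - lam) * φ a + (1 / 2 * φ a + a / 2 * φ' a) = 0 := by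
          refine (h.lower.hasDerivAt a).unique ?_
          rw [show (fun x : ℝ => φ' x + x / 2 * φ x) = fun _ => 0 from funext h0]
          exact hasDerivAt_const a 0
        have := hup a
        rw [h0 a, hχ', mul_zero, sub_zero] at this
        have := (mul_eq_zero.mp this).resolve_right ha
        rw [sub_eq_zero.mp this]
        simp
      · have hconst : ∀ y : ℝ, HasDerivAt (fun y : ℝ => φ y * Complex.exp ((y : ℂ) ^ 2 / 4)) 0 y := by
          intro y
          have hx : HasDerivAt (fun x : ℝ => (x : ℂ)) 1 y := 
            (hasDerivAt_id (y : ℂ)).comp_ofReal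
          refine ((h.hasDerivAt y).mul ((hx.pow 2).div_const 4).cexp).congr_deriv ?_
          have := h0 y
          simp only [Pi.pow_apply]
          push_cast
          linear_combination Complex.exp ((y : ℂ) ^ 2 / 4) * this
        have := is_const_of_deriv_eq_zero (fun y => (hconst y).differentiableAt)
          (fun y => (hconst y).deriv) x 0
        simp only [Complex.ofReal_zero, ne_eq, OfNat.ofNat_ne_zero, not_false_eq_true, zero_pow,
          zero_div, Complex.exp_zero, mul_one] at this
        rw [← this, neg_div, Complex.exp_neg]
        simp [Complex.exp_ne_zero]
    · right
      have hlam' : lam = (m + 1 : ℕ) + 1 / 2 := by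
        push_cast
        linear_combination hm
      refine ⟨m + 1, c / (m + 1), hlam', fun x => ?_⟩
      have hm1 : (m : ℂ) + 1 ≠ 0 := by exact_mod_cast Nat.succ_ne_zero m
      have hp : HasDerivAt (fun x : ℝ => aeval (x : ℂ) (hermite m))
          (aeval (x : ℂ) (derivative (hermite m))) x :=
        ((hermite m).hasDerivAt_aeval (x : ℂ)).comp_ofReal
      have hχ' := (h.lower.hasDerivAt x).unique (by
        rw [show (fun x : ℝ => φ' x + x / 2 * φ x) = _ from funext hc]
        exact (hp.mul ((hasDerivAt_cexp_neg_sq_div_four x).comp_ofReal)).const_mul c)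
      have := hup x
      rw [hc x, hχ', hlam'] at this
      rw [hermite_succ, map_sub, map_mul, aeval_X]
      push_cast at this
      rw [div_mul_eq_mul_div, eq_div_iff hm1]
      linear_combination this

end OscillatorSolution

end Oscillator

/-! ### Square-integrability excludes simple poles -/

section Pole

open Filter Topology Set MeasureTheory

/-- A square-integrable function has no simple pole. -/
theorem eq_zero_of_memLp_two_of_simple_pole {h N : ℝ → ℂ} {a : ℝ} (hL : MemLp h 2 volume)
    (hN : ContinuousAt N a) (heq : ∀ᶠ x : ℝ in 𝓝[≠] a, ((x : ℂ) - a) * h x = N x) : N a = 0 := by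
  by_contra hne
  have hpos : 0 < ‖N a‖ / 2 := by positivity
  -- If `N a ≠ 0`, then `h` dominates `1/(x - a)`, which is not integrable up to `a`; but `L²` on a
  -- bounded interval lies in `L¹`.
  have hO : (fun x : ℝ => (x - a)⁻¹) =O[𝓝[≠] a] h := by
    refine Asymptotics.IsBigO.of_bound (‖N a‖ / 2)⁻¹ ?_
    have hev : ∀ᶠ x in 𝓝[≠] a, ‖N a‖ / 2 < ‖N x‖ :=
      (hN.norm.eventually (lt_mem_nhds (half_lt_self (norm_pos_iff.mpr hne)))).filter_mono
        nhdsWithin_le_nhds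
    filter_upwards [heq, hev, self_mem_nhdsWithin] with x hx hx' hxa
    have hxa' : 0 < ‖x - a‖ := norm_pos_iff.mpr (sub_ne_zero.mpr hxa)
    have e : ‖x - a‖ * ‖h x‖ = ‖N x‖ := by
      rw [← hx, norm_mul, ← Complex.ofReal_sub, Complex.norm_real]
    rw [norm_inv, ← div_eq_inv_mul, inv_eq_one_div, div_le_div_iff₀ hxa' hpos]
    linarith
  have hInt : IntervalIntegrable h volume a (a + 1) :=
    (intervalIntegrable_iff_integrableOn_Ioc_of_le (by linarith)).mpr
      ((hL.restrict (Ioc a (a + 1))).integrable one_le_two)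
  exact not_intervalIntegrable_of_sub_inv_isBigO_punctured hO (by simp) left_mem_uIcc hInt

end Pole

/-! ### Darboux transformation to the oscillator -/

section Darboux

open Filter Topology Set MeasureTheory

/-- The superpotential `z / 2 - 1 / (z - 1) - 1 / (z + 1)`. -/
noncomputable def superpotential (z : ℂ) : ℂ := z / 2 - 1 / (z - 1) - 1 / (z + 1)

/-- The rescaled partner potential `z² / 4 + 2 / (z - 1)² + 2 / (z + 1)² - 3 / 2`. -/
noncomputable def partnerPotential (z : ℂ) : ℂ :=
  z ^ 2 / 4 + 2 / (z - 1) ^ 2 + 2 / (z + 1) ^ 2 - 3 / 2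

theorem hasDerivAt_superpotential {z : ℂ} (h1 : z ≠ 1) (h2 : z ≠ -1) :
    HasDerivAt superpotential (1 / 2 + 1 / (z - 1) ^ 2 + 1 / (z + 1) ^ 2) z := by
  have e1 : z - 1 ≠ 0 := sub_ne_zero.mpr h1
  have e2 : z + 1 ≠ 0 := fun h => h2 (eq_neg_of_add_eq_zero_left h)
  have d1 := ((hasDerivAt_id z).sub_const 1).inv e1
  have d2 := ((hasDerivAt_id z).add_const 1).inv e2
  have := (((hasDerivAt_id z).div_const 2).sub d1).sub d2
  have hf : superpotential = fun z => z / 2 - (z - 1)⁻¹ - (z + 1)⁻¹ := by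
    funext z
    simp [superpotential]
  rw [hf]
  refine HasDerivAt.congr_deriv this ?_
  simp only [id]
  ring

theorem superpotential_sq_add {z : ℂ} (h1 : z ≠ 1) (h2 : z ≠ -1) :
    superpotential z ^ 2 + (1 / 2 + 1 / (z - 1) ^ 2 + 1 / (z + 1) ^ 2) = partnerPotential z := by
  have e1 : z - 1 ≠ 0 := sub_ne_zero.mpr h1
  have e2 : z + 1 ≠ 0 := fun h => h2 (eq_neg_of_add_eq_zero_left h)
  unfold superpotential partnerPotential
  field_simp
  ring

theorem superpotential_sq_sub {z : ℂ} (h1 : z ≠ 1) (h2 : z ≠ -1) :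
    superpotential z ^ 2 - (1 / 2 + 1 / (z - 1) ^ 2 + 1 / (z + 1) ^ 2) = z ^ 2 / 4 - 5 / 2 := by
  have e1 : z - 1 ≠ 0 := sub_ne_zero.mpr h1
  have e2 : z + 1 ≠ 0 := fun h => h2 (eq_neg_of_add_eq_zero_left h)
  unfold superpotential
  field_simp
  ring

/-- `f' = w f + g` and `g' = -w g - ε f` on `U`, with `w` the superpotential: the first-order form
of `f'' = (partnerPotential - ε) f`. -/
structure DarbouxPair (ε : ℂ) (U : Set ℂ) (f g : ℂ → ℂ) : Prop where
  hasDerivAt_left : ∀ z ∈ U, HasDerivAt f (superpotential z * f z + g z) z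
  hasDerivAt_right : ∀ z ∈ U, HasDerivAt g (-(superpotential z * g z) - ε * f z) z

theorem darbouxPair_of_ode {U : Set ℂ} (hU : IsOpen U) (h1 : (1 : ℂ) ∉ U) (h2 : (-1 : ℂ) ∉ U)
    {ε : ℂ} {f : ℂ → ℂ} (hf : DifferentiableOn ℂ f U)
    (hode : ∀ z ∈ U, deriv (deriv f) z = (partnerPotential z - ε) * f z) :
    DarbouxPair ε U f fun z => deriv f z - superpotential z * f z := by
  have d1 : ∀ z ∈ U, HasDerivAt f (deriv f z) z := fun z hz =>
    (hf.differentiableAt (hU.mem_nhds hz)).hasDerivAt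
  refine ⟨fun z hz => (d1 z hz).congr_deriv (by ring), fun z hz => ?_⟩
  have n1 : z ≠ 1 := fun h => h1 (h ▸ hz)
  have n2 : z ≠ -1 := fun h => h2 (h ▸ hz)
  have d2 : HasDerivAt (deriv f) ((partnerPotential z - ε) * f z) z := by
    rw [← hode z hz]
    exact ((hf.deriv hU).differentiableAt (hU.mem_nhds hz)).hasDerivAt
  refine (d2.sub ((hasDerivAt_superpotential n1 n2).mul (d1 z hz))).congr_deriv ?_
  rw [← superpotential_sq_add n1 n2]
  ring

namespace DarbouxPair

variable {ε : ℂ} {U : Set ℂ} {f g : ℂ → ℂ}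

theorem hasDerivAt_left' (h : DarbouxPair ε U f g) {z : ℂ} (hz : z ∈ U) (n1 : z ≠ 1)
    (n2 : z ≠ -1) :
    HasDerivAt (fun z => superpotential z * f z + g z) ((partnerPotential z - ε) * f z) z := by
  refine (((hasDerivAt_superpotential n1 n2).mul (h.hasDerivAt_left z hz)).add
    (h.hasDerivAt_right z hz)).congr_deriv ?_
  rw [← superpotential_sq_add n1 n2]
  ring

/-- `g'' = (w² - w' - ε) g`, and the poles cancel in `w² - w'`. -/
theorem hasDerivAt_right' (h : DarbouxPair ε U f g) {z : ℂ} (hz : z ∈ U) (n1 : z ≠ 1)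
    (n2 : z ≠ -1) :
    HasDerivAt (fun z => -(superpotential z * g z) - ε * f z)
      ((z ^ 2 / 4 - (5 / 2 + ε)) * g z) z := by
  refine (((hasDerivAt_superpotential n1 n2).mul (h.hasDerivAt_right z hz)).neg.sub
    ((h.hasDerivAt_left z hz).const_mul ε)).congr_deriv ?_
  have := superpotential_sq_sub n1 n2
  linear_combination g z * this

end DarbouxPair

theorem partnerPotential_neg (z : ℂ) : partnerPotential (-z) = partnerPotential z := by
  unfold partnerPotential
  rw [show (-z - 1) ^ 2 = (z + 1) ^ 2 by ring, show (-z + 1) ^ 2 = (z - 1) ^ 2 by ring]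
  ring

theorem partnerPotential_ofReal (x : ℝ) :
    partnerPotential x = ((x ^ 2 / 4 + 2 / (x - 1) ^ 2 + 2 / (x + 1) ^ 2 - 3 / 2 : ℝ) : ℂ) := by
  unfold partnerPotential
  push_cast
  ring

theorem rapidDecay_of_partner_ode {ε : ℂ} {f f' : ℝ → ℂ}
    (hf : ∀ x, 1 < x → HasDerivAt f (f' x) x)
    (hf' : ∀ x : ℝ, 1 < x → HasDerivAt f' ((partnerPotential x - ε) * f x) x)
    (hInt : IntegrableOn (fun x => ‖f x‖ ^ 2) (Ioi 1)) :
    RapidDecay atTop f ∧ RapidDecay atTop f' := by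
  refine rapidDecay_of_integrableOn_sq (C := 6 + ‖ε‖) hf hf' ?_ ?_ hInt
  · have h1 : Tendsto (fun x : ℝ => x ^ 2 / 4 - (3 / 2 + ε.re)) atTop atTop :=
      tendsto_atTop_add_const_right _ _
        ((tendsto_pow_atTop two_ne_zero).atTop_div_const (by norm_num))
    refine tendsto_atTop_mono (fun x => ?_) h1
    rw [partnerPotential_ofReal, Complex.sub_re, Complex.ofReal_re]
    have e1 : 0 ≤ 2 / (x - 1) ^ 2 := by positivity
    have e2 : 0 ≤ 2 / (x + 1) ^ 2 := by positivity
    linarith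
  · filter_upwards [eventually_ge_atTop 2] with x hx
    have e1 : 0 ≤ 2 / (x - 1) ^ 2 := by positivity
    have e2 : 0 ≤ 2 / (x + 1) ^ 2 := by positivity
    have e3 : 2 / (x - 1) ^ 2 ≤ 2 := div_le_self (by norm_num) (by nlinarith)
    have e4 : 2 / (x + 1) ^ 2 ≤ 2 := div_le_self (by norm_num) (by nlinarith)
    have e5 : ‖partnerPotential x‖ ≤ 6 * x ^ 2 := by
      rw [partnerPotential_ofReal, Complex.norm_real, Real.norm_eq_abs, abs_le]
      constructor <;> nlinarith
    refine (norm_sub_le _ _).trans ?_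
    nlinarith [norm_nonneg ε, mul_nonneg (norm_nonneg ε) (by nlinarith : 0 ≤ x ^ 2 - 1)]

theorem RapidDecay.superpotential_mul {f : ℝ → ℂ} (hf : RapidDecay (cocompact ℝ) f) :
    RapidDecay (cocompact ℝ) fun x : ℝ => superpotential x * f x := by
  have hlim : ∀ c : ℝ, Tendsto (fun x : ℝ => (((x + c)⁻¹ : ℝ) : ℂ)) (cocompact ℝ) (𝓝 0) := by
    intro c
    have h : Tendsto (fun x : ℝ => (x + c)⁻¹) (cocompact ℝ) (𝓝 0) := by
      rw [cocompact_eq_atBot_atTop, tendsto_sup]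
      exact ⟨tendsto_inv_atBot_zero.comp (tendsto_atBot_add_const_right _ c tendsto_id),
        tendsto_inv_atTop_zero.comp (tendsto_atTop_add_const_right _ c tendsto_id)⟩
    exact_mod_cast (Complex.continuous_ofReal.tendsto 0).comp h
  refine (((hf.ofReal_mul.const_mul (1 / 2)).sub (hf.tendsto_mul (hlim (-1)))).sub
    (hf.tendsto_mul (hlim 1))).congr' (.of_forall fun x => ?_)
  simp only [superpotential]
  push_cast
  ring

end Darboux

/-! ### Vanishing of square-integrable solutions -/

section NoBoundState

open Filter Topology Set MeasureTheory

namespace DarbouxPair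

variable {ε : ℂ} {U : Set ℂ} {f g : ℂ → ℂ}

theorem rapidDecay_left (h : DarbouxPair ε U f g)
    (hreal : ∀ x : ℝ, x ≠ 1 → x ≠ -1 → (x : ℂ) ∈ U)
    (hL : MemLp (fun x : ℝ => f x) 2 volume) :
    RapidDecay (cocompact ℝ) (fun x : ℝ => f x) ∧
      RapidDecay (cocompact ℝ) (fun x : ℝ => superpotential x * f x + g x) := by
  have hsq : Integrable (fun x : ℝ => ‖f x‖ ^ 2) := by
    simpa using hL.integrable_norm_pow two_ne_zero
  have hne : ∀ x : ℝ, 1 < |x| → (x : ℂ) ∈ U ∧ (x : ℂ) ≠ 1 ∧ (x : ℂ) ≠ -1 := fun x hx => by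
    have n1 : x ≠ 1 := fun e => by simp [e] at hx
    have n2 : x ≠ -1 := fun e => by simp [e] at hx
    exact ⟨hreal x n1 n2, by exact_mod_cast n1, by exact_mod_cast n2⟩
  have htop := rapidDecay_of_partner_ode (ε := ε) (f := fun x : ℝ => f x)
    (f' := fun x : ℝ => superpotential x * f x + g x)
    (fun x hx => by
      obtain ⟨hU, -, -⟩ := hne x (hx.trans_le (le_abs_self x))
      exact (h.hasDerivAt_left _ hU).comp_ofReal)
    (fun x hx => by
      obtain ⟨hU, n1, n2⟩ := hne x (hx.trans_le (le_abs_self x))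
      exact (h.hasDerivAt_left' hU n1 n2).comp_ofReal)
    hsq.integrableOn
  have hneg : ∀ x : ℝ, 1 < x → (-(x : ℂ)) ∈ U ∧ -(x : ℂ) ≠ 1 ∧ -(x : ℂ) ≠ -1 := fun x hx => by
    have := hne (-x) (by rw [abs_neg]; exact hx.trans_le (le_abs_self x))
    exact_mod_cast this
  have hbot := rapidDecay_of_partner_ode (ε := ε) (f := fun x : ℝ => f (-x))
    (f' := fun x : ℝ => -(superpotential (-x) * f (-x) + g (-x)))
    (fun x hx => by
      obtain ⟨hU, -, -⟩ := hneg x hx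
      have := ((h.hasDerivAt_left _ hU).comp (x : ℂ) (hasDerivAt_neg (x : ℂ))).comp_ofReal
      exact this.congr_deriv (by ring))
    (fun x hx => by
      obtain ⟨hU, n1, n2⟩ := hneg x hx
      have := ((h.hasDerivAt_left' hU n1 n2).comp (x : ℂ) (hasDerivAt_neg (x : ℂ))).comp_ofReal.neg
      refine this.congr_deriv ?_
      rw [partnerPotential_neg]
      ring)
    (by
      have := hsq.comp_neg
      push_cast at this
      exact this.integrableOn)
  rw [cocompact_eq_atBot_atTop]
  refine ⟨RapidDecay.sup (RapidDecay.of_comp_neg ?_) htop.1,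
    RapidDecay.sup (RapidDecay.of_comp_neg ?_) htop.2⟩
  · simpa using hbot.1
  · refine (hbot.2.const_mul (-1)).congr' (.of_forall fun x => ?_)
    push_cast
    ring

open Polynomial in
theorem eq_zero_of_eigenvalue_ne_zero (h : DarbouxPair ε U f g) (hε : ε ≠ 0) (hU : IsOpen U)
    (hUc : IsPreconnected U) (h1 : (1 : ℂ) ∉ U) (h2 : (-1 : ℂ) ∉ U)
    (hreal : ∀ x : ℝ, x ≠ 1 → x ≠ -1 → (x : ℂ) ∈ U)
    (hL : MemLp (fun x : ℝ => f x) 2 volume) (x : ℝ) (hx1 : x ≠ 1) (hx2 : x ≠ -1) :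
    f x = 0 := by
  have n1 : ∀ z ∈ U, z ≠ 1 := fun z hz e => h1 (e ▸ hz)
  have n2 : ∀ z ∈ U, z ≠ -1 := fun z hz e => h2 (e ▸ hz)
  obtain ⟨φ, φ', hφ, hφ', hg, hg'⟩ := exists_entire_extension hU hUc h.hasDerivAt_right
    fun z hz => h.hasDerivAt_right' hz (n1 z hz) (n2 z hz)
  have hf : ∀ z ∈ U, f z = -(φ' z + superpotential z * φ z) / ε := fun z hz => by
    rw [← hg z hz, ← hg' z hz]
    field_simp
    ring
  have hφ1 : φ 1 = 0 := by
    -- `(x - 1) f` with the pole of the superpotential cleared; its value at `1` is `φ 1 / ε`.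
    set N : ℝ → ℂ := fun x => -(((x : ℂ) - 1) * φ' x +
      (((x : ℂ) - 1) * x / 2 - 1 - ((x : ℂ) - 1) / (x + 1)) * φ x) / ε with hN
    have c1 : ContinuousAt (fun x : ℝ => φ x) 1 := (hφ _).comp_ofReal.continuousAt
    have c2 : ContinuousAt (fun x : ℝ => φ' x) 1 := (hφ' _).comp_ofReal.continuousAt
    have hNc : ContinuousAt N 1 := by
      have c3 : ContinuousAt (fun x : ℝ => ((x : ℂ) - 1) / (x + 1)) 1 := by
        refine ContinuousAt.div (by fun_prop) (by fun_prop) ?_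
        norm_num
      have c4 : ContinuousAt (fun x : ℝ => (x : ℂ) - 1) 1 := by fun_prop
      have c5 : ContinuousAt (fun x : ℝ => ((x : ℂ) - 1) * x / 2 - 1) 1 := by fun_prop
      exact (((c4.mul c2).add ((c5.sub c3).mul c1)).neg).div_const ε
    have h0 : N 1 = 0 := by
      refine eq_zero_of_memLp_two_of_simple_pole hL hNc ?_
      have hev : ∀ᶠ x : ℝ in 𝓝[≠] 1, x ≠ -1 :=
        (isOpen_ne.mem_nhds (by norm_num : (1 : ℝ) ≠ -1)) |> mem_nhdsWithin_of_mem_nhds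
      filter_upwards [hev, self_mem_nhdsWithin] with y hy2 hy1
      have hyU := hreal y hy1 hy2
      have e1 : (y : ℂ) - 1 ≠ 0 := sub_ne_zero.mpr (n1 _ hyU)
      have e2 : (y : ℂ) + 1 ≠ 0 := fun e => n2 _ hyU (eq_neg_of_add_eq_zero_left e)
      rw [hf _ hyU, hN]
      simp only [superpotential, Complex.ofReal_one]
      field_simp
    simpa [hN, hε] using h0
  have hosc : OscillatorSolution (5 / 2 + ε) (fun x : ℝ => φ x) fun x : ℝ => φ' x :=
    ⟨fun x => (hφ x).comp_ofReal, fun x => (hφ' x).comp_ofReal⟩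
  have hev : ∀ᶠ x : ℝ in cocompact ℝ, (x : ℂ) ∈ U := by
    have : ({1, -1} : Set ℝ)ᶜ ∈ cocompact ℝ :=
      ((Set.finite_singleton (-1 : ℝ)).insert 1).isCompact.compl_mem_cocompact
    filter_upwards [this] with x hx
    simp only [mem_compl_iff, mem_insert_iff, mem_singleton_iff, not_or] at hx
    exact hreal x hx.1 hx.2
  obtain ⟨d1, d2⟩ := h.rapidDecay_left hreal hL
  have dg : RapidDecay (cocompact ℝ) fun x : ℝ => g x :=
    (d2.sub d1.superpotential_mul).congr' (.of_forall fun x => by ring)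
  have dφ : RapidDecay (cocompact ℝ) fun x : ℝ => φ x :=
    dg.congr' (hev.mono fun x hx => hg _ hx)
  have dφ' : RapidDecay (cocompact ℝ) fun x : ℝ => φ' x :=
    ((dg.superpotential_mul.const_mul (-1)).sub (d1.const_mul ε)).congr'
      (hev.mono fun x hx => by
        simp only [← hg' _ hx]
        ring)
  have hzero : ∀ x : ℝ, φ x = 0 := by
    obtain ⟨n, hn⟩ := exists_nat_ge (5 / 2 + ε).re
    rcases OscillatorSolution.eq_zero_or_eq_hermite_of_re_le n _ _ _ hosc dφ dφ' hn with
      h0 | ⟨m, c, hm, hc⟩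
    · exact h0
    -- `5/2 + ε = m + 1/2`, so `m = 2` would mean `ε = 0`.
    · have hm2 : m ≠ 2 := fun e => hε (by
        rw [e] at hm
        push_cast at hm
        linear_combination hm)
      have hc1 := hc 1
      rw [Complex.ofReal_one, hφ1, aeval_def, eval₂_at_one] at hc1
      have hc0 : c = 0 := by
        have he : ((algebraMap ℤ ℂ) ((hermite m).eval 1)) ≠ 0 := by
          simpa using eval_one_hermite_ne_zero hm2
        have := hc1.symm
        simp only [mul_eq_zero, Complex.exp_ne_zero, he, or_false] at this
        exact this
      intro x
      rw [hc x, hc0, zero_mul]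
  have hzero' : φ' x = 0 := by
    refine (hosc.hasDerivAt x).unique ?_
    rw [show (fun x : ℝ => φ x) = fun _ => 0 from funext hzero]
    exact hasDerivAt_const x 0
  rw [hf _ (hreal x hx1 hx2), hzero, hzero']
  simp

/-- This is the Hermite function with `m = 2`; it spans the solutions of `g' = -w g`, the equation
of `g` when `ε = 0`. -/
theorem hasDerivAt_zeroMode {z : ℂ} (n1 : z ≠ 1) (n2 : z ≠ -1) :
    HasDerivAt (fun z : ℂ => (z ^ 2 - 1) * Complex.exp (-z ^ 2 / 4))
      (-(superpotential z * ((z ^ 2 - 1) * Complex.exp (-z ^ 2 / 4)))) z := by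
  have e1 : z - 1 ≠ 0 := sub_ne_zero.mpr n1
  have e2 : z + 1 ≠ 0 := fun h => n2 (eq_neg_of_add_eq_zero_left h)
  refine (((hasDerivAt_pow 2 z).sub_const 1).mul
    (hasDerivAt_cexp_neg_sq_div_four z)).congr_deriv ?_
  simp only [superpotential]
  generalize Complex.exp (-z ^ 2 / 4) = t
  field_simp
  push_cast
  ring

theorem zeroMode_ne_zero {z : ℂ} (n1 : z ≠ 1) (n2 : z ≠ -1) :
    (z ^ 2 - 1) * Complex.exp (-z ^ 2 / 4) ≠ 0 := by
  have e1 : z - 1 ≠ 0 := sub_ne_zero.mpr n1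
  have e2 : z + 1 ≠ 0 := fun h => n2 (eq_neg_of_add_eq_zero_left h)
  refine mul_ne_zero ?_ (Complex.exp_ne_zero _)
  rw [show z ^ 2 - 1 = (z - 1) * (z + 1) by ring]
  exact mul_ne_zero e1 e2

theorem eq_zero_of_eigenvalue_eq_zero (h : DarbouxPair 0 U f g) (hU : IsOpen U)
    (hUc : IsPreconnected U) (h1 : (1 : ℂ) ∉ U) (h2 : (-1 : ℂ) ∉ U)
    (hreal : ∀ x : ℝ, x ≠ 1 → x ≠ -1 → (x : ℂ) ∈ U)
    (hL : MemLp (fun x : ℝ => f x) 2 volume) (x : ℝ) (hx1 : x ≠ 1) (hx2 : x ≠ -1) :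
    f x = 0 := by
  have n1 : ∀ z ∈ U, z ≠ 1 := fun z hz e => h1 (e ▸ hz)
  have n2 : ∀ z ∈ U, z ≠ -1 := fun z hz e => h2 (e ▸ hz)
  set G : ℂ → ℂ := fun z => (z ^ 2 - 1) * Complex.exp (-z ^ 2 / 4) with hG
  have dG : ∀ z ∈ U, HasDerivAt G (-(superpotential z * G z)) z := fun z hz =>
    hasDerivAt_zeroMode (n1 z hz) (n2 z hz)
  have G0 : ∀ z ∈ U, G z ≠ 0 := fun z hz => zeroMode_ne_zero (n1 z hz) (n2 z hz)
  obtain ⟨c, hc⟩ : ∃ c, ∀ z ∈ U, g z / G z = c := by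
    have hd : ∀ z ∈ U, HasDerivAt (fun z => g z / G z) 0 z := fun z hz => by
      refine ((h.hasDerivAt_right z hz).div (dG z hz) (G0 z hz)).congr_deriv ?_
      rw [div_eq_zero_iff]
      left
      ring
    exact hU.exists_is_const_of_deriv_eq_zero hUc
      (fun z hz => (hd z hz).differentiableAt.differentiableWithinAt) fun z hz => (hd z hz).deriv
  have hgG : ∀ z ∈ U, g z = c * G z := fun z hz => (div_eq_iff (G0 z hz)).mp (hc z hz)
  obtain ⟨P, hP⟩ : Complex.IsExactOn (fun z => G z ^ 2) univ :=
    Differentiable.isExactOn_univ (by simp only [hG]; fun_prop)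
  -- The superpotential terms cancel in `(f G)' = g G = c G²`. The constants `c` and `d` serve all
  -- three intervals.
  obtain ⟨d, hd⟩ : ∃ d, ∀ z ∈ U, f z * G z - c * P z = d := by
    have hd : ∀ z ∈ U, HasDerivAt (fun z => f z * G z - c * P z) 0 z := fun z hz => by
      refine (((h.hasDerivAt_left z hz).mul (dG z hz)).sub
        ((hP z (mem_univ z)).const_mul c)).congr_deriv ?_
      rw [hgG z hz]
      ring
    exact hU.exists_is_const_of_deriv_eq_zero hUc
      (fun z hz => (hd z hz).differentiableAt.differentiableWithinAt) fun z hz => (hd z hz).deriv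
  have hpole : ∀ a : ℝ, a = 1 ∨ a = -1 → c * P a + d = 0 := by
    intro a ha
    have ha2 : (a : ℂ) ^ 2 = 1 := by rcases ha with rfl | rfl <;> norm_num
    have ha0 : (a : ℂ) + a ≠ 0 := by rcases ha with rfl | rfl <;> norm_num
    -- This is `(x - a) f`, since `x² - 1 = (x - a)(x + a)` for `a = ±1`.
    set N : ℝ → ℂ := fun x => (c * P x + d) / ((x + a) * Complex.exp (-(x : ℂ) ^ 2 / 4)) with hN
    have hNc : ContinuousAt N a := by
      have c1 : ContinuousAt (fun x : ℝ => P x) a := (hP _ (mem_univ _)).comp_ofReal.continuousAt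
      refine ContinuousAt.div ((continuousAt_const.mul c1).add continuousAt_const)
        (by fun_prop) (mul_ne_zero ha0 (Complex.exp_ne_zero _))
    have h0 : N a = 0 := by
      refine eq_zero_of_memLp_two_of_simple_pole hL hNc ?_
      have hev : ∀ᶠ x : ℝ in 𝓝[≠] a, x ≠ -a := by
        refine mem_nhdsWithin_of_mem_nhds (isOpen_ne.mem_nhds ?_)
        rcases ha with rfl | rfl <;> norm_num
      filter_upwards [hev, self_mem_nhdsWithin] with y hy2 hy1
      have hyU : (y : ℂ) ∈ U := by
        rcases ha with rfl | rfl
        · exact hreal y hy1 hy2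
        · exact hreal y (by simpa using hy2) hy1
      have e2 : (y : ℂ) + a ≠ 0 := fun e => hy2 (by
        have := eq_neg_of_add_eq_zero_left e
        exact_mod_cast this)
      simp only [hN]
      rw [eq_div_iff (mul_ne_zero e2 (Complex.exp_ne_zero _)), ← hd _ hyU]
      simp only [hG]
      linear_combination (-(f y * Complex.exp (-(y : ℂ) ^ 2 / 4))) * ha2
    have := div_eq_zero_iff.mp h0
    exact this.resolve_right (mul_ne_zero ha0 (Complex.exp_ne_zero _))
  have hp1 := hpole 1 (Or.inl rfl)
  have hp2 := hpole (-1) (Or.inr rfl)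
  -- Subtracting the conditions at `±1` gives `c (P 1 - P (-1)) = 0`, and the difference is the
  -- integral of `G² > 0` over `(-1, 1)`.
  have hc0 : c = 0 := by
    set r : ℝ → ℝ := fun x => ((x ^ 2 - 1) * Real.exp (-x ^ 2 / 4)) ^ 2 with hr
    have hrc : Continuous r := by simp only [hr]; fun_prop
    have hrG : ∀ x : ℝ, G x ^ 2 = (r x : ℂ) := fun x => by
      simp only [hG, hr]
      push_cast
      rfl
    have hI : ∫ x in (-1 : ℝ)..1, (r x : ℂ) = P (1 : ℝ) - P (-1 : ℝ) := by
      refine intervalIntegral.integral_eq_sub_of_hasDerivAt (f := fun x : ℝ => P x)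
        (fun x _ => ?_) ?_
      · rw [← hrG]
        exact (hP x (mem_univ _)).comp_ofReal
      · exact (Complex.continuous_ofReal.comp hrc).intervalIntegrable _ _
    rw [intervalIntegral.integral_ofReal] at hI
    have hpos : 0 < ∫ x in (-1 : ℝ)..1, r x := by
      refine intervalIntegral.intervalIntegral_pos_of_pos_on (hrc.intervalIntegrable _ _)
        (fun x hx => ?_) (by norm_num)
      have : x ^ 2 - 1 ≠ 0 := by nlinarith [hx.1, hx.2]
      have := Real.exp_pos (-x ^ 2 / 4)
      positivity
    have h0 : c * ((∫ x in (-1 : ℝ)..1, r x : ℝ) : ℂ) = 0 := by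
      rw [hI]
      linear_combination hp1 - hp2
    exact (mul_eq_zero.mp h0).resolve_right (by exact_mod_cast hpos.ne')
  have hxU := hreal x hx1 hx2
  have hfin := hd _ hxU
  rw [hc0, zero_mul, zero_add] at hp1
  rw [hc0, zero_mul, sub_zero, hp1] at hfin
  exact (mul_eq_zero.mp hfin).resolve_right (G0 _ hxU)

end DarbouxPair

end NoBoundState

/-! ### The operators `H₁` and `H₂` in closed form -/

namespace DressingChain

section Operators

theorem sqrt_two_factor_sq (hbar : ℝ) :
    (-(Complex.I * hbar) / (Real.sqrt 2 : ℂ)) ^ 2 = -(hbar : ℂ) ^ 2 / 2 := by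
  have h2 : (Real.sqrt 2 : ℂ) ^ 2 = 2 := by
    exact_mod_cast Real.sq_sqrt (by norm_num : (0 : ℝ) ≤ 2)
  rw [div_pow, neg_sq, mul_pow, Complex.I_sq, h2]
  ring

theorem b_eq (hbar α : ℝ) (ψ : ℂ → ℂ) : b hbar α ψ = fun z =>
    -(Complex.I * hbar) / (Real.sqrt 2 : ℂ) *
      (deriv ψ z + (z / (2 * α ^ 2) + poleTerm α z) * ψ z) := by
  funext z
  simp only [b, momentum]
  ring

theorem bDagger_eq (hbar α : ℝ) (ψ : ℂ → ℂ) : bDagger hbar α ψ = fun z =>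
    -(Complex.I * hbar) / (Real.sqrt 2 : ℂ) *
      (deriv ψ z - (z / (2 * α ^ 2) + poleTerm α z) * ψ z) := by
  funext z
  simp only [bDagger, momentum]
  ring

theorem momentum_momentum (hbar : ℝ) (ψ : ℂ → ℂ) (z : ℂ) :
    momentum hbar (momentum hbar ψ) z = -(hbar : ℂ) ^ 2 * deriv (deriv ψ) z := by
  unfold momentum
  rw [deriv_const_mul_field]
  linear_combination (hbar : ℂ) ^ 2 * deriv (deriv ψ) z * Complex.I_sq

theorem hasDerivAt_poleTerm {α : ℝ} {z : ℂ} (h1 : z ≠ α) (h2 : z ≠ -α) :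
    HasDerivAt (poleTerm α) (1 / (z - α) ^ 2 + 1 / (z + α) ^ 2) z := by
  have e1 : z - α ≠ 0 := sub_ne_zero.mpr h1
  have e2 : z + α ≠ 0 := fun h => h2 (eq_neg_of_add_eq_zero_left h)
  have hf : poleTerm α = fun z : ℂ => -(z - α)⁻¹ - (z + α)⁻¹ := by
    funext z
    simp only [poleTerm]
    ring
  rw [hf]
  refine ((((hasDerivAt_id z).sub_const (α : ℂ)).inv e1).neg.sub
    (((hasDerivAt_id z).add_const (α : ℂ)).inv e2)).congr_deriv ?_
  simp only [id]
  ring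

theorem hasDerivAt_scaledSuperpotential {α : ℝ} {z : ℂ} (h1 : z ≠ α) (h2 : z ≠ -α) :
    HasDerivAt (fun z : ℂ => z / (2 * α ^ 2) + poleTerm α z)
      (1 / (2 * α ^ 2) + (1 / (z - α) ^ 2 + 1 / (z + α) ^ 2)) z :=
  ((hasDerivAt_id z).div_const _).add (hasDerivAt_poleTerm h1 h2)

/-- The linear term times the poles leaves `-2/α² - 2/(z² - α²)`; the last part cancels the product
of the two poles. -/
theorem scaledSuperpotential_sq {α : ℝ} (hα : α ≠ 0) {z : ℂ} (h1 : z ≠ α) (h2 : z ≠ -α) :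
    (z / (2 * α ^ 2) + poleTerm α z) ^ 2 =
      z ^ 2 / (4 * α ^ 4) - 2 / α ^ 2 + (1 / (z - α) ^ 2 + 1 / (z + α) ^ 2) := by
  have e0 : (α : ℂ) ≠ 0 := by exact_mod_cast hα
  have e1 : z - α ≠ 0 := sub_ne_zero.mpr h1
  have e2 : z + α ≠ 0 := fun h => h2 (eq_neg_of_add_eq_zero_left h)
  unfold poleTerm
  field_simp
  ring

theorem H₁_apply (hbar : ℝ) {α : ℝ} (hα : α ≠ 0) {ψ : ℂ → ℂ} {z : ℂ} (h1 : z ≠ α) (h2 : z ≠ -α)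
    (hψ : AnalyticAt ℂ ψ z) :
    H₁ hbar α ψ z = momentum hbar (momentum hbar ψ) z / 2
      + (hbar ^ 2 * z ^ 2 / (8 * α ^ 4) - 5 * hbar ^ 2 / (4 * α ^ 2)) * ψ z := by
  have d0 := hψ.differentiableAt.hasDerivAt
  have d1 := hψ.deriv.differentiableAt.hasDerivAt
  have hW := hasDerivAt_scaledSuperpotential h1 h2
  have hd := ((d1.add (hW.mul d0)).const_mul (-(Complex.I * hbar) / (Real.sqrt 2 : ℂ))).deriv
  have hsq := scaledSuperpotential_sq hα h1 h2
  rw [H₁, bDagger_eq, b_eq, momentum_momentum]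
  simp only
  erw [hd]
  set κ := -(Complex.I * hbar) / (Real.sqrt 2 : ℂ) with hκ
  have hκ2 : κ ^ 2 = -(hbar : ℂ) ^ 2 / 2 := sqrt_two_factor_sq hbar
  set W := z / (2 * (α : ℂ) ^ 2) + poleTerm α z
  set D := 1 / (z - (α : ℂ)) ^ 2 + 1 / (z + α) ^ 2
  linear_combination (deriv (deriv ψ) z + (1 / (2 * (α : ℂ) ^ 2) + D) * ψ z - W ^ 2 * ψ z) * hκ2 +
    (hbar : ℂ) ^ 2 / 2 * ψ z * hsq

theorem H₂_apply (hbar : ℝ) {α : ℝ} (hα : α ≠ 0) {ψ : ℂ → ℂ} {z : ℂ} (h1 : z ≠ α) (h2 : z ≠ -α)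
    (hψ : AnalyticAt ℂ ψ z) :
    H₂ hbar α ψ z = momentum hbar (momentum hbar ψ) z / 2
      + (V hbar α z - 3 * hbar ^ 2 / (4 * α ^ 2)) * ψ z := by
  have d0 := hψ.differentiableAt.hasDerivAt
  have d1 := hψ.deriv.differentiableAt.hasDerivAt
  have hW := hasDerivAt_scaledSuperpotential h1 h2
  have hd := ((d1.sub (hW.mul d0)).const_mul (-(Complex.I * hbar) / (Real.sqrt 2 : ℂ))).deriv
  have hsq := scaledSuperpotential_sq hα h1 h2
  rw [H₂, b_eq, bDagger_eq, momentum_momentum]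
  simp only
  erw [hd]
  set κ := -(Complex.I * hbar) / (Real.sqrt 2 : ℂ) with hκ
  have hκ2 : κ ^ 2 = -(hbar : ℂ) ^ 2 / 2 := sqrt_two_factor_sq hbar
  set W := z / (2 * (α : ℂ) ^ 2) + poleTerm α z
  have hV : V hbar α z = hbar ^ 2 * z ^ 2 / (8 * α ^ 4) +
      hbar ^ 2 * (1 / (z - (α : ℂ)) ^ 2 + 1 / (z + α) ^ 2) := by
    unfold V
    ring
  rw [hV]
  set D := 1 / (z - (α : ℂ)) ^ 2 + 1 / (z + α) ^ 2
  linear_combination (deriv (deriv ψ) z - (1 / (2 * (α : ℂ) ^ 2) + D) * ψ z - W ^ 2 * ψ z) * hκ2 +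
    (hbar : ℂ) ^ 2 / 2 * ψ z * hsq

theorem rescaled_ode {hbar α : ℝ} (hhbar : 0 < hbar) (hα : α ≠ 0) {E y d v : ℂ} (h1 : y ≠ 1)
    (h2 : y ≠ -1)
    (h : -(hbar : ℂ) ^ 2 * d / 2 + (V hbar α (α * y) - 3 * hbar ^ 2 / (4 * α ^ 2)) * v = E * v) :
    (α : ℂ) ^ 2 * d = (partnerPotential y - 2 * E * α ^ 2 / hbar ^ 2) * v := by
  have e0 : (α : ℂ) ≠ 0 := by exact_mod_cast hα
  have e3 : (hbar : ℂ) ≠ 0 := by exact_mod_cast hhbar.ne'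
  have e1 : y - 1 ≠ 0 := sub_ne_zero.mpr h1
  have e2 : y + 1 ≠ 0 := fun h => h2 (eq_neg_of_add_eq_zero_left h)
  have hV : V hbar α (α * y) = hbar ^ 2 / (2 * α ^ 2) * (partnerPotential y + 3 / 2) := by
    unfold V partnerPotential
    rw [show (α : ℂ) * y - α = α * (y - 1) by ring, show (α : ℂ) * y + α = α * (y + 1) by ring]
    field_simp
    ring
  rw [hV] at h
  field_simp at h ⊢
  linear_combination (-1 / 8 : ℂ) * h

end Operators

end DressingChain

/-! ### Rescaling and conclusion -/

section Main

open Filter Topology Set MeasureTheory DressingChain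

theorem not_memLp_two_of_isEigenfunction {hbar α : ℝ} (hhbar : 0 < hbar) (hα : α ≠ 0) {E : ℂ}
    {ψ : ℝ → ℂ} (hψ : IsEigenfunction hbar α E ψ) : ¬ MemLp ψ 2 volume := by
  intro hL
  obtain ⟨⟨x, hx1, hx2, hx⟩, U, Ψ, hU, hUc, hp, hm, hreal, hd, hH, heq⟩ := hψ
  have e0 : (α : ℂ) ≠ 0 := by exact_mod_cast hα
  set T : ℂ ≃ₜ ℂ := Homeomorph.mulLeft₀ (α : ℂ) e0
  have hT : ∀ y, T y = α * y := fun _ => rfl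
  set U' : Set ℂ := T ⁻¹' U
  have hU' : IsOpen U' := hU.preimage T.continuous
  have hUc' : IsPreconnected U' := (T.isPreconnected_preimage).mpr hUc.isPreconnected
  have h1 : (1 : ℂ) ∉ U' := fun h => hp (by simpa [U', hT] using h)
  have h2 : (-1 : ℂ) ∉ U' := fun h => hm (by simpa [U', hT] using h)
  have hne : ∀ y : ℝ, y ≠ 1 → y ≠ -1 → α * y ≠ α ∧ α * y ≠ -α := fun y hy1 hy2 =>
    ⟨fun e => hy1 (mul_left_cancel₀ hα (by simpa using e)),
      fun e => hy2 (mul_left_cancel₀ hα (by simpa using e))⟩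
  have hreal' : ∀ y : ℝ, y ≠ 1 → y ≠ -1 → (y : ℂ) ∈ U' := fun y hy1 hy2 => by
    have := hreal (α * y) (hne y hy1 hy2).1 (hne y hy1 hy2).2
    simpa [U', hT] using this
  have hd' : DifferentiableOn ℂ (fun y => Ψ (α * y)) U' :=
    hd.comp (f := fun y : ℂ => α * y) (by fun_prop) fun y hy => hy
  have hode : ∀ y ∈ U', deriv (deriv fun y => Ψ (α * y)) y =
      (partnerPotential y - 2 * E * α ^ 2 / hbar ^ 2) * Ψ (α * y) := by
    intro y hy
    have hy1 : y ≠ 1 := fun e => h1 (e ▸ hy)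
    have hy2 : y ≠ -1 := fun e => h2 (e ▸ hy)
    have hz1 : (α : ℂ) * y ≠ α := fun e => hp (by rw [← e]; exact hy)
    have hz2 : (α : ℂ) * y ≠ -α := fun e => hm (by rw [← e]; exact hy)
    have han : AnalyticAt ℂ Ψ (α * y) := hd.analyticAt (hU.mem_nhds hy)
    have hHy := hH (α * y) hy
    rw [H₂_apply hbar hα hz1 hz2 han, momentum_momentum] at hHy
    have hderiv : deriv (fun y => Ψ (α * y)) = fun y => (α : ℂ) * deriv Ψ (α * y) :=
      funext fun y => by simpa using deriv_comp_mul_left (α : ℂ) Ψ y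
    rw [hderiv, deriv_const_mul_field, ← rescaled_ode hhbar hα hy1 hy2 hHy]
    have := deriv_comp_mul_left (α : ℂ) (deriv Ψ) y
    rw [this, smul_eq_mul]
    ring
  have hL' : MemLp (fun y : ℝ => Ψ (α * (y : ℂ))) 2 volume := by
    -- Scaling by `α` multiplies Lebesgue measure by a finite constant; the two poles are null.
    have hmap : MemLp ψ 2 (Measure.map (α * ·) volume) := by
      rw [Real.map_volume_mul_left hα]
      exact hL.smul_measure ENNReal.ofReal_ne_top
    have hcomp := hmap.comp_of_map (measurable_const_mul α).aemeasurable
    refine (memLp_congr_ae ?_).mp hcomp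
    have hae : ({1, -1} : Set ℝ)ᶜ ∈ ae (volume : Measure ℝ) :=
      compl_mem_ae_iff.mpr (((Set.finite_singleton (-1 : ℝ)).insert 1).measure_zero volume)
    filter_upwards [hae] with y hy
    simp only [mem_compl_iff, mem_insert_iff, mem_singleton_iff, not_or] at hy
    have := heq (α * y) (hne y hy.1 hy.2).1 (hne y hy.1 hy.2).2
    simp only [Function.comp]
    rw [← this]
    push_cast
    rfl
  have hpair := darbouxPair_of_ode hU' h1 h2 hd' hode
  have hzero : ∀ y : ℝ, y ≠ 1 → y ≠ -1 → Ψ (α * (y : ℂ)) = 0 := by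
    intro y hy1 hy2
    by_cases hε : 2 * E * (α : ℂ) ^ 2 / (hbar : ℂ) ^ 2 = 0
    · rw [hε] at hpair
      exact hpair.eq_zero_of_eigenvalue_eq_zero hU' hUc' h1 h2 hreal' hL' y hy1 hy2
    · exact hpair.eq_zero_of_eigenvalue_ne_zero hε hU' hUc' h1 h2 hreal' hL' y hy1 hy2
  refine hx ?_
  have hx1' : x / α ≠ 1 := fun e => hx1 (by rwa [div_eq_one_iff_eq hα] at e)
  have hx2' : x / α ≠ -1 := fun e => hx2 (by rw [div_eq_iff hα] at e; linarith)
  have := hzero (x / α) hx1' hx2'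
  rw [← heq x hx1 hx2, ← this]
  congr 1
  push_cast
  field_simp

end Main

theorem mainTheorem2 (hbar α : ℝ) (hhbar : 0 < hbar) (hα : α ≠ 0) :
    (∀ (ψ : ℂ → ℂ) (z : ℂ), z ≠ α → z ≠ -α → AnalyticAt ℂ ψ z →
      DressingChain.H₁ hbar α ψ z =
          DressingChain.momentum hbar (DressingChain.momentum hbar ψ) z / 2
            + (hbar ^ 2 * z ^ 2 / (8 * α ^ 4) - 5 * hbar ^ 2 / (4 * α ^ 2)) * ψ z ∧
      DressingChain.H₂ hbar α ψ z =
          DressingChain.momentum hbar (DressingChain.momentum hbar ψ) z / 2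
            + (DressingChain.V hbar α z - 3 * hbar ^ 2 / (4 * α ^ 2)) * ψ z) ∧
    ¬ ∃ (E : ℂ) (ψ : ℝ → ℂ),
        DressingChain.IsEigenfunction hbar α E ψ ∧
        MeasureTheory.MemLp ψ 2 MeasureTheory.volume := by
  refine ⟨fun ψ z h1 h2 hψ => ⟨DressingChain.H₁_apply hbar hα h1 h2 hψ,
    DressingChain.H₂_apply hbar hα h1 h2 hψ⟩, ?_⟩
  rintro ⟨E, ψ, hψ, hL⟩
  exact not_memLp_two_of_isEigenfunction hhbar hα hψ hL
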